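/- A super-ring is a ring with unit $A=A_0\oplus A_1$ graded by $\mathbb Z/2$; it is assumed super-commutative: even elements are central and $a^2=0$ for every $a\in A_1$. A super-ideal is a homogeneous ideal; $A$ is Noetherian if its super-ideals satisfy the ascending chain condition. A super-ideal $\mathfrak p$ is prime (maximal) if $A/\mathfrak p$ is an integral domain (a field), and $A_{\mathfrak p}=(A_0\setminus\mathfrak p_0)^{-1}A$, where $\mathfrak p_0=\mathfrak p\cap A_0$. A super-ring is local if it has a unique maximal super-ideal. For a Noetherian super-ring $R$ with $\operatorname{Kdim}(R_0)<\infty$, elements $y_1,\dots,y_s\in R_1$ form a system of odd parameters if $\operatorname{Kdim}(R_0)=\operatorname{Kdim}\bigl(R_0/\operatorname{Ann}_{R_0}(y_1\cdots y_s)\bigr)$. The Krull super-dimension of $R$ is $\operatorname{Ksdim}(R)=r\mid s$, where $r=\operatorname{Kdim}(R_0)$ and $s$ is the largest length of a system of odd parameters. A Noetherian local super-ring $R$ with maximal super-ideal $\mathfrak m$ and residue field $K=R/\mathfrak m$ is regular if $\operatorname{Ksdim}(R)=\dim_K(\mathfrak m/\mathfrak m^2)_0\mid\dim_K(\mathfrak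 m/\mathfrak m^2)_1$. A Noetherian super-ring $A$ is regular if the local super-ring $A_{\mathfrak p}$ is regular for every prime super-ideal $\mathfrak p$ of $A$. Let $I_A=AA_1$ and $\overline A=A/I_A$ (a commutative ring), let $\operatorname{gr}_{I_A}(A)=\bigoplus_{n\ge 0}I_A^n/I_A^{n+1}$, a graded $\overline A$-algebra, and let $$\lambda_A:\wedge_{\overline A}(I_A/I_A^2)\to\operatorname{gr}_{I_A}(A)$$ be the $\overline A$-algebra map induced by the embedding $I_A/I_A^2\to\operatorname{gr}_{I_A}(A)$. **Proposition.** For a Noetherian super-ring $A$ the following are equivalent: (a) $A$ is regular; (b) (i) the ring $\overline A$ is regular, (ii) the $\overline A$-module $I_A/I_A^2$ is projective, and (iii) $\lambda_A$ is an isomorphism. -/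

import Mathlib

universe u

/-! ## Super-commutative super-rings

A super-ring is a ring `A` with a grading `𝒜 : ZMod 2 → AddSubgroup A` and `[GradedRing 𝒜]`. -/

/-- Super-commutativity: even elements commute with all homogeneous elements, and odd elements
have square zero. -/
class SuperCommutative {A : Type u} [Ring A] (𝒜 : ZMod 2 → AddSubgroup A) : Prop where
  even_mul_comm : ∀ r ∈ 𝒜 0, ∀ i : ZMod 2, ∀ s ∈ 𝒜 i, r * s = s * r
  odd_mul_self : ∀ s ∈ 𝒜 1, s * s = 0

namespace SuperRing

section Basic

theorem odd_anticomm {A : Type u} [Ring A] (𝒜 : ZMod 2 → AddSubgroup A)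
    [SuperCommutative 𝒜] {x y : A} (hx : x ∈ 𝒜 1) (hy : y ∈ 𝒜 1) : x * y = -(y * x) := by
  have h := SuperCommutative.odd_mul_self (𝒜 := 𝒜) (x + y) (add_mem hx hy)
  have h1 := SuperCommutative.odd_mul_self (𝒜 := 𝒜) x hx
  have h2 := SuperCommutative.odd_mul_self (𝒜 := 𝒜) y hy
  rw [mul_add, add_mul, add_mul, h1, h2, zero_add, add_zero] at h
  exact eq_neg_of_add_eq_zero_right h

variable {A : Type u} [Ring A] (𝒜 : ZMod 2 → AddSubgroup A) [GradedRing 𝒜]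

theorem exists_even_add_odd (a : A) : ∃ e ∈ 𝒜 0, ∃ o ∈ 𝒜 1, a = e + o := by
  induction a using DirectSum.Decomposition.inductionOn 𝒜 with
  | zero => exact ⟨0, zero_mem _, 0, zero_mem _, (add_zero 0).symm⟩
  | @homogeneous i m =>
    have hi : ∀ k : ZMod 2, k = 0 ∨ k = 1 := by decide
    rcases hi i with rfl | rfl
    · exact ⟨m, m.2, 0, zero_mem _, (add_zero _).symm⟩
    · exact ⟨0, zero_mem _, m, m.2, (zero_add _).symm⟩
  | add a b ha hb =>
    obtain ⟨e, he, o, ho, rfl⟩ := ha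
    obtain ⟨e', he', o', ho', rfl⟩ := hb
    exact ⟨e + e', add_mem he he', o + o', add_mem ho ho', add_add_add_comm _ _ _ _⟩

variable [SuperCommutative 𝒜]

theorem even_comm {r : A} (hr : r ∈ 𝒜 0) (a : A) : r * a = a * r := by
  obtain ⟨e, he, o, ho, rfl⟩ := exists_even_add_odd 𝒜 a
  rw [mul_add, add_mul, SuperCommutative.even_mul_comm r hr 0 e he,
    SuperCommutative.even_mul_comm r hr 1 o ho]

/-- The even part `A₀`, a commutative ring. -/
instance evenCommRing : CommRing (𝒜 0) :=
  { SetLike.GradeZero.instRing 𝒜 with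
    mul_comm := fun a b => Subtype.ext (even_comm 𝒜 a.2 (b : A)) }

/-- `A` is an algebra over its even part. -/
instance evenAlgebra : Algebra (𝒜 0) A :=
  RingHom.toAlgebra' (SetLike.GradeZero.subring 𝒜).subtype (fun r a => even_comm 𝒜 r.2 a)

theorem even_smul_def (r : 𝒜 0) (a : A) : r • a = (r : A) * a := rfl

/-- The homogeneous component `𝒜 i` as an `A₀`-submodule of `A`. -/
def component (i : ZMod 2) : Submodule (𝒜 0) A :=
  { 𝒜 i with
    smul_mem' := fun r a ha => by
      have h := SetLike.GradedMul.mul_mem (A := 𝒜) r.2 ha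
      rw [zero_add] at h
      exact h }

/-- The super-ideal `I_A = A A₁`. -/
def oddIdeal : Ideal A := Ideal.span (𝒜 1 : Set A)

instance oddIdeal_isTwoSided : (oddIdeal 𝒜).IsTwoSided where
  mul_mem_of_left {a} b ha := by
    induction ha using Submodule.span_induction with
    | mem x hx =>
      obtain ⟨e, he, o, ho, rfl⟩ := exists_even_add_odd 𝒜 b
      rw [mul_add, ← even_comm 𝒜 he, odd_anticomm 𝒜 hx ho]
      exact add_mem (Ideal.mul_mem_left _ _ (Ideal.subset_span hx))
        (neg_mem (Ideal.mul_mem_left _ _ (Ideal.subset_span hx)))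
    | zero => rw [zero_mul]; exact zero_mem _
    | add x y _ _ hx hy => rw [add_mul]; exact add_mem hx hy
    | smul r x _ hx => rw [smul_eq_mul, mul_assoc]; exact Ideal.mul_mem_left _ _ hx

/-- The ring `A / I_A`. -/
abbrev Body : Type u := A ⧸ oddIdeal 𝒜

/-- Every element of `A / I_A` is represented by an even element. -/
theorem body_exists_even (a : Body 𝒜) :
    ∃ e : 𝒜 0, Ideal.Quotient.mk (oddIdeal 𝒜) (e : A) = a := by
  obtain ⟨a, rfl⟩ := Ideal.Quotient.mk_surjective a
  obtain ⟨e, he, o, ho, rfl⟩ := exists_even_add_odd 𝒜 a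
  refine ⟨⟨e, he⟩, ?_⟩
  have h : Ideal.Quotient.mk (oddIdeal 𝒜) o = 0 :=
    Ideal.Quotient.eq_zero_iff_mem.2 (Ideal.subset_span ho)
  rw [map_add, h, add_zero]

instance bodyCommRing : CommRing (Body 𝒜) :=
  { Ideal.Quotient.ring (oddIdeal 𝒜) with
    mul_comm := fun a b => by
      obtain ⟨e, rfl⟩ := body_exists_even 𝒜 a
      obtain ⟨b, rfl⟩ := Ideal.Quotient.mk_surjective b
      exact congrArg (Ideal.Quotient.mk (oddIdeal 𝒜)) (even_comm 𝒜 e.2 b) }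

end Basic

/-! ## The associated graded ring of a two-sided ideal -/

section AssociatedGraded

variable {R : Type u} [Ring R] (I : Ideal R)

/-- The piece `Iⁿ / Iⁿ⁺¹`. -/
def GrPiece (n : ℕ) : Type u :=
  ↥(I ^ n) ⧸ Submodule.submoduleOf (I ^ (n + 1)) (I ^ n)

instance grPieceAddCommGroup (n : ℕ) : AddCommGroup (GrPiece I n) :=
  Submodule.Quotient.addCommGroup (Submodule.submoduleOf (I ^ (n + 1)) (I ^ n))

instance grPieceModule (n : ℕ) : Module R (GrPiece I n) :=
  Submodule.Quotient.module (Submodule.submoduleOf (I ^ (n + 1)) (I ^ n))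

/-- The class in `Iⁿ / Iⁿ⁺¹` of an element of `Iⁿ`. -/
def grMk (n : ℕ) (x : ↥(I ^ n)) : GrPiece I n := Submodule.Quotient.mk x

theorem grMk_surjective (n : ℕ) : Function.Surjective (grMk I n) :=
  Submodule.Quotient.mk_surjective _

theorem grMk_eq_iff {n : ℕ} {x y : ↥(I ^ n)} :
    grMk I n x = grMk I n y ↔ (x : R) - y ∈ I ^ (n + 1) :=
  (Submodule.Quotient.eq (Submodule.submoduleOf (I ^ (n + 1)) (I ^ n))).trans Iff.rfl

theorem grMk_congr {m n : ℕ} (h : m = n) (x : ↥(I ^ m)) (y : ↥(I ^ n)) (hxy : (x : R) = y) :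
    (GradedMonoid.mk m (grMk I m x) : GradedMonoid (GrPiece I)) =
      GradedMonoid.mk n (grMk I n y) := by
  subst h
  rw [Subtype.ext hxy]

theorem grMk_add {n : ℕ} (x y : ↥(I ^ n)) : grMk I n (x + y) = grMk I n x + grMk I n y := rfl

variable [I.IsTwoSided]

theorem mul_mem_pow_add {m n : ℕ} {x y : R} (hx : x ∈ I ^ m) (hy : y ∈ I ^ n) :
    x * y ∈ I ^ (m + n) := by
  rw [Ideal.IsTwoSided.pow_add]
  exact Ideal.mul_mem_mul hx hy

/-- Multiplication `Iᵐ / Iᵐ⁺¹ × Iⁿ / Iⁿ⁺¹ → Iᵐ⁺ⁿ / Iᵐ⁺ⁿ⁺¹`, induced by that of `R`. -/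
def grMul {m n : ℕ} (a : GrPiece I m) (b : GrPiece I n) : GrPiece I (m + n) :=
  Quotient.liftOn₂' a b
    (fun x y => grMk I (m + n) ⟨(x : R) * y, mul_mem_pow_add I x.2 y.2⟩)
    (fun x y x' y' hx hy => by
      have hx' : (x : R) - x' ∈ I ^ (m + 1) := (grMk_eq_iff I).1 (Quotient.sound' hx)
      have hy' : (y : R) - y' ∈ I ^ (n + 1) := (grMk_eq_iff I).1 (Quotient.sound' hy)
      rw [grMk_eq_iff]
      have h1 := mul_mem_pow_add I hx' y.2
      have h2 := mul_mem_pow_add I x'.2 hy'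
      rw [Nat.add_right_comm] at h1
      rw [← Nat.add_assoc] at h2
      have h3 := add_mem h1 h2
      have h4 : (x : R) * y - x' * y' = (x - x') * y + x' * (y - y') := by noncomm_ring
      exact h4 ▸ h3)

theorem grMul_mk {m n : ℕ} (x : ↥(I ^ m)) (y : ↥(I ^ n)) :
    grMul I (grMk I m x) (grMk I n y) =
      grMk I (m + n) ⟨(x : R) * y, mul_mem_pow_add I x.2 y.2⟩ := rfl

/-- The unit of the associated graded ring, in degree zero. -/
def grOne : GrPiece I 0 := grMk I 0 ⟨1, by rw [Submodule.pow_zero, Ideal.one_eq_top]; trivial⟩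

instance grGMul : GradedMonoid.GMul (GrPiece I) where
  mul a b := grMul I a b

instance grGOne : GradedMonoid.GOne (GrPiece I) where
  one := grOne I

/-- The graded ring structure on the family `Iⁿ / Iⁿ⁺¹`, making `⨁ n, Iⁿ / Iⁿ⁺¹` a ring. -/
instance grGRing : DirectSum.GRing (GrPiece I) where
  mul_zero {i j} a := by
    obtain ⟨x, rfl⟩ := grMk_surjective I i a
    change grMul I (grMk I i x) (grMk I j 0) = grMk I (i + j) 0
    rw [grMul_mk]
    congr 1
    exact Subtype.ext (mul_zero _)
  zero_mul {i j} b := by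
    obtain ⟨y, rfl⟩ := grMk_surjective I j b
    change grMul I (grMk I i 0) (grMk I j y) = grMk I (i + j) 0
    rw [grMul_mk]
    congr 1
    exact Subtype.ext (zero_mul _)
  mul_add {i j} a b c := by
    obtain ⟨x, rfl⟩ := grMk_surjective I i a
    obtain ⟨y, rfl⟩ := grMk_surjective I j b
    obtain ⟨z, rfl⟩ := grMk_surjective I j c
    change grMul I (grMk I i x) (grMk I j (y + z)) =
      grMul I (grMk I i x) (grMk I j y) + grMul I (grMk I i x) (grMk I j z)
    rw [grMul_mk, grMul_mk, grMul_mk, ← grMk_add]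
    congr 1
    exact Subtype.ext (mul_add _ _ _)
  add_mul {i j} a b c := by
    obtain ⟨x, rfl⟩ := grMk_surjective I i a
    obtain ⟨y, rfl⟩ := grMk_surjective I i b
    obtain ⟨z, rfl⟩ := grMk_surjective I j c
    change grMul I (grMk I i (x + y)) (grMk I j z) =
      grMul I (grMk I i x) (grMk I j z) + grMul I (grMk I i y) (grMk I j z)
    rw [grMul_mk, grMul_mk, grMul_mk, ← grMk_add]
    congr 1
    exact Subtype.ext (add_mul _ _ _)
  one_mul := by
    rintro ⟨n, a⟩
    obtain ⟨x, rfl⟩ := grMk_surjective I n a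
    exact grMk_congr I (zero_add n) _ _ (one_mul _)
  mul_one := by
    rintro ⟨n, a⟩
    obtain ⟨x, rfl⟩ := grMk_surjective I n a
    exact grMk_congr I (add_zero n) _ _ (mul_one _)
  mul_assoc := by
    rintro ⟨l, a⟩ ⟨m, b⟩ ⟨n, c⟩
    obtain ⟨x, rfl⟩ := grMk_surjective I l a
    obtain ⟨y, rfl⟩ := grMk_surjective I m b
    obtain ⟨z, rfl⟩ := grMk_surjective I n c
    exact grMk_congr I (add_assoc l m n) _ _ (mul_assoc _ _ _)
  natCast n := n • grOne I
  natCast_zero := zero_smul _ _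
  natCast_succ n := succ_nsmul _ _
  intCast n := n • grOne I
  intCast_ofNat n := natCast_zsmul _ _
  intCast_negSucc_ofNat n := negSucc_zsmul _ _

/-- `Iⁿ / Iⁿ⁺¹` is annihilated by `I`. -/
theorem grPiece_isTorsionBySet (n : ℕ) : Module.IsTorsionBySet R (GrPiece I n) I := by
  rintro a ⟨r, hr⟩
  obtain ⟨x, rfl⟩ := grMk_surjective I n a
  change grMk I n (r • x) = grMk I n 0
  rw [grMk_eq_iff]
  change r * (x : R) - 0 ∈ _
  rw [sub_zero, Ideal.IsTwoSided.pow_succ]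
  exact Ideal.mul_mem_mul hr x.2

end AssociatedGraded

section Lambda

variable {A : Type u} [Ring A] (𝒜 : ZMod 2 → AddSubgroup A) [GradedRing 𝒜] [SuperCommutative 𝒜]

/-- The piece `I_Aⁿ / I_Aⁿ⁺¹` of `gr_{I_A}(A)`. -/
abbrev OddGr (n : ℕ) : Type u := GrPiece (oddIdeal 𝒜) n

/-- `I_Aⁿ / I_Aⁿ⁺¹` is a module over `A / I_A`, the action being induced by that of `A`. -/
noncomputable instance oddGrModule (n : ℕ) : Module (Body 𝒜) (OddGr 𝒜 n) :=
  (grPiece_isTorsionBySet (oddIdeal 𝒜) n).module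

theorem body_smul_mk (n : ℕ) (r : A) (x : ↥(oddIdeal 𝒜 ^ n)) :
    Ideal.Quotient.mk (oddIdeal 𝒜) r • grMk (oddIdeal 𝒜) n x = grMk (oddIdeal 𝒜) n (r • x) := rfl

/-- The structure map of the `A / I_A`-algebra `gr_{I_A}(A) = ⨁ n, I_Aⁿ / I_Aⁿ⁺¹`: it sends the
class of `a` to the class of `a` in degree zero. -/
noncomputable instance oddGrAlgebra : DirectSum.GAlgebra (Body 𝒜) (OddGr 𝒜) where
  toFun := (LinearMap.toSpanSingleton (Body 𝒜) (OddGr 𝒜 0) (grOne (oddIdeal 𝒜))).toAddMonoidHom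
  map_one := one_smul (Body 𝒜) (grOne (oddIdeal 𝒜))
  map_mul r s := by
    obtain ⟨a, rfl⟩ := Ideal.Quotient.mk_surjective r
    obtain ⟨b, rfl⟩ := Ideal.Quotient.mk_surjective s
    refine grMk_congr (oddIdeal 𝒜) (zero_add 0).symm _ _ ?_
    change a * b * 1 = (a * 1) * (b * 1)
    simp only [mul_one]
  commutes := by
    rintro r ⟨n, x⟩
    obtain ⟨e, rfl⟩ := body_exists_even 𝒜 r
    obtain ⟨x, rfl⟩ := grMk_surjective (oddIdeal 𝒜) n x
    refine grMk_congr (oddIdeal 𝒜) ((zero_add n).trans (add_zero n).symm) _ _ ?_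
    change ((e : A) * 1) * (x : A) = x * (e * 1)
    rw [mul_one, even_comm 𝒜 e.2]
  smul_def := by
    rintro r ⟨n, x⟩
    obtain ⟨a, rfl⟩ := Ideal.Quotient.mk_surjective r
    obtain ⟨x, rfl⟩ := grMk_surjective (oddIdeal 𝒜) n x
    refine grMk_congr (oddIdeal 𝒜) (zero_add n).symm _ _ ?_
    change a * (x : A) = (a * 1) * x
    rw [mul_one]

/-- The graded algebra `gr_{I_A}(A) = ⨁ n, I_Aⁿ / I_Aⁿ⁺¹`. -/
abbrev AssocGr : Type u := DirectSum ℕ (OddGr 𝒜)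

noncomputable instance assocGrRing : Ring (AssocGr 𝒜) := inferInstance

noncomputable instance assocGrAlgebra : Algebra (Body 𝒜) (AssocGr 𝒜) := inferInstance

/-- The embedding of `I_A / I_A²` in `gr_{I_A}(A)`. -/
noncomputable def grEmbedding : OddGr 𝒜 1 →ₗ[Body 𝒜] AssocGr 𝒜 :=
  DirectSum.lof (Body 𝒜) ℕ (OddGr 𝒜) 1

theorem exists_odd_add_sq {x : A} (hx : x ∈ oddIdeal 𝒜) :
    ∃ o ∈ 𝒜 1, ∃ t ∈ oddIdeal 𝒜 ^ 2, x = o + t := by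
  induction hx using Submodule.span_induction with
  | mem x hx => exact ⟨x, hx, 0, zero_mem _, (add_zero x).symm⟩
  | zero => exact ⟨0, zero_mem _, 0, zero_mem _, (add_zero 0).symm⟩
  | add x y _ _ hx hy =>
    obtain ⟨o, ho, t, ht, rfl⟩ := hx
    obtain ⟨o', ho', t', ht', rfl⟩ := hy
    exact ⟨o + o', add_mem ho ho', t + t', add_mem ht ht', add_add_add_comm _ _ _ _⟩
  | smul r x _ hx =>
    obtain ⟨o, ho, t, ht, rfl⟩ := hx
    obtain ⟨e, he, p, hp, rfl⟩ := exists_even_add_odd 𝒜 r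
    have h1 : e * o ∈ 𝒜 1 := (component 𝒜 1).smul_mem ⟨e, he⟩ ho
    have h2 : p * o ∈ oddIdeal 𝒜 ^ 2 := by
      rw [Ideal.IsTwoSided.pow_succ, Submodule.pow_one]
      exact Ideal.mul_mem_mul (Ideal.subset_span hp) (Ideal.subset_span ho)
    refine ⟨e * o, h1, p * o + (e + p) * t, add_mem h2 (Ideal.mul_mem_left _ _ ht), ?_⟩
    rw [smul_eq_mul]
    noncomm_ring

/-- The square of an element of `I_A` lies in `I_A³`. -/
theorem sq_mem_cube {x : A} (hx : x ∈ oddIdeal 𝒜) : x * x ∈ oddIdeal 𝒜 ^ 3 := by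
  obtain ⟨o, ho, t, ht, rfl⟩ := exists_odd_add_sq 𝒜 hx
  have hoI : o ∈ oddIdeal 𝒜 ^ 1 := by
    rw [Submodule.pow_one]
    exact Ideal.subset_span ho
  have h1 : o * t ∈ oddIdeal 𝒜 ^ (1 + 2) := mul_mem_pow_add _ hoI ht
  have h2 : t * o ∈ oddIdeal 𝒜 ^ (2 + 1) := mul_mem_pow_add _ ht hoI
  have h3 : t * t ∈ oddIdeal 𝒜 ^ (2 + 1) := by
    refine mul_mem_pow_add _ ht ?_
    have h : o + t - o ∈ oddIdeal 𝒜 := sub_mem hx (Ideal.subset_span ho)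
    rwa [add_sub_cancel_left, ← Submodule.pow_one (oddIdeal 𝒜)] at h
  have h4 : (o + t) * (o + t) = o * t + (t * o + t * t) := by
    rw [mul_add, add_mul, add_mul, SuperCommutative.odd_mul_self (𝒜 := 𝒜) o ho, zero_add]
    abel
  rw [h4]
  exact add_mem h1 (add_mem h2 h3)

theorem grEmbedding_sq (m : OddGr 𝒜 1) : grEmbedding 𝒜 m * grEmbedding 𝒜 m = 0 := by
  obtain ⟨x, rfl⟩ := grMk_surjective (oddIdeal 𝒜) 1 m
  change DirectSum.of (OddGr 𝒜) 1 _ * DirectSum.of (OddGr 𝒜) 1 _ = 0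
  rw [DirectSum.of_mul_of]
  have h : grMul (oddIdeal 𝒜) (grMk (oddIdeal 𝒜) 1 x) (grMk (oddIdeal 𝒜) 1 x) =
      grMk (oddIdeal 𝒜) (1 + 1) 0 := by
    rw [grMul_mk, grMk_eq_iff]
    change (x : A) * x - 0 ∈ _
    rw [sub_zero]
    exact sq_mem_cube 𝒜 ((Submodule.pow_one (oddIdeal 𝒜)).le x.2)
  change DirectSum.of (OddGr 𝒜) (1 + 1) (grMul (oddIdeal 𝒜) _ _) = 0
  rw [h]
  exact map_zero (DirectSum.of (OddGr 𝒜) (1 + 1))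

/-- The algebra map `λ_A : ⋀ (I_A / I_A²) → gr_{I_A}(A)` over `A / I_A`, induced by the
embedding of `I_A / I_A²` in `gr_{I_A}(A)`. -/
noncomputable def lam : ExteriorAlgebra (Body 𝒜) (OddGr 𝒜 1) →ₐ[Body 𝒜] AssocGr 𝒜 :=
  ExteriorAlgebra.lift (Body 𝒜) ⟨grEmbedding 𝒜, grEmbedding_sq 𝒜⟩

end Lambda

/-! ## Noetherian super-rings and localization -/

/-- A super-ring is Noetherian if its super-ideals (that is, its homogeneous ideals) satisfy the
ascending chain condition. -/
def IsNoetherianSuperRing {A : Type u} [Ring A] (𝒜 : ZMod 2 → AddSubgroup A) [GradedRing 𝒜] :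
    Prop :=
  WellFoundedGT (HomogeneousIdeal 𝒜)

section Localization

variable {A : Type u} [Ring A] (𝒜 : ZMod 2 → AddSubgroup A) [GradedRing 𝒜] [SuperCommutative 𝒜]

/-- The ideal `𝔭₀ = 𝔭 ∩ A₀` of `A₀`, for a super-ideal `𝔭`. -/
def evenPart (𝔭 : HomogeneousIdeal 𝒜) : Ideal (𝒜 0) :=
  𝔭.toIdeal.comap (algebraMap (𝒜 0) A)

/-- The multiplicative set `A₀ ∖ 𝔭₀` of a prime super-ideal. A super-ideal `𝔭` is prime if
`A / 𝔭` is a domain, which is the meaning of `𝔭.toIdeal.IsPrime`. -/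
def evenCompl (𝔭 : HomogeneousIdeal 𝒜) [h : 𝔭.toIdeal.IsPrime] : Submonoid (𝒜 0) where
  carrier := {s | s ∉ evenPart 𝒜 𝔭}
  one_mem' := fun h1 => h.ne_top ((Ideal.eq_top_iff_one _).2 h1)
  mul_mem' := fun ha hb hab => (h.mem_or_mem hab).elim ha hb

variable (S : Submonoid (𝒜 0))

/-- The grading of `S⁻¹ A`, for a multiplicative set `S` of even elements: the component of
degree `i` consists of the fractions `a / s` with `a` of degree `i`. -/
def locGrading (i : ZMod 2) : AddSubgroup (LocalizedModule S A) where
  carrier := {x | ∃ a ∈ 𝒜 i, ∃ s : S, x = LocalizedModule.mk a s}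
  zero_mem' := ⟨0, zero_mem _, 1, (LocalizedModule.zero_mk 1).symm⟩
  add_mem' := by
    rintro _ _ ⟨a, ha, s, rfl⟩ ⟨b, hb, t, rfl⟩
    exact ⟨t • a + s • b, add_mem ((component 𝒜 i).smul_mem (t : 𝒜 0) ha)
      ((component 𝒜 i).smul_mem (s : 𝒜 0) hb), s * t, LocalizedModule.mk_add_mk⟩
  neg_mem' := by
    rintro _ ⟨a, ha, s, rfl⟩
    exact ⟨-a, neg_mem ha, s, LocalizedModule.mk_neg.symm⟩

instance locGradedMonoid : SetLike.GradedMonoid (locGrading 𝒜 S) where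
  one_mem := ⟨1, SetLike.GradedOne.one_mem, 1, OreLocalization.one_def⟩
  mul_mem := by
    rintro i j _ _ ⟨a, ha, s, rfl⟩ ⟨b, hb, t, rfl⟩
    exact ⟨a * b, SetLike.GradedMul.mul_mem ha hb, s * t, LocalizedModule.mk_mul_mk⟩

/-- The projection of `A` to its component of degree `i`, as an `A₀`-linear map. -/
def evenProj (i : ZMod 2) : A →ₗ[𝒜 0] A where
  toFun a := DirectSum.decompose 𝒜 a i
  map_add' a b := by simp
  map_smul' r a := by
    rw [even_smul_def, RingHom.id_apply, even_smul_def]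
    exact DirectSum.coe_decompose_mul_of_left_mem_zero 𝒜 r.2

/-- The projection of `S⁻¹ A` to its component of degree `i`. -/
noncomputable def locProj (i : ZMod 2) : LocalizedModule S A →+ locGrading 𝒜 S i :=
  (LocalizedModule.map S (evenProj 𝒜 i)).toAddMonoidHom.codRestrict (locGrading 𝒜 S i) (by
    intro x
    induction x with
    | _ a s => exact ⟨_, SetLike.coe_mem (DirectSum.decompose 𝒜 a i), s, LocalizedModule.map_mk _ _ _ _⟩)

theorem locProj_mk (i : ZMod 2) (a : A) (s : S) :
    (locProj 𝒜 S i (LocalizedModule.mk a s) : LocalizedModule S A) =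
      LocalizedModule.mk (DirectSum.decompose 𝒜 a i : A) s :=
  LocalizedModule.map_mk _ _ _ _

/-- The decomposition of an element of `S⁻¹ A` into its homogeneous components. -/
noncomputable def locDecompose : LocalizedModule S A →+ DirectSum (ZMod 2) (fun i => locGrading 𝒜 S i) :=
  ∑ i : ZMod 2, (DirectSum.of (fun i => locGrading 𝒜 S i) i).comp (locProj 𝒜 S i)

theorem mk_sum {ι : Type} (t : Finset ι) (f : ι → A) (s : S) :
    (LocalizedModule.mk (∑ i ∈ t, f i) s : LocalizedModule S A) =
      ∑ i ∈ t, LocalizedModule.mk (f i) s := by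
  classical
  induction t using Finset.induction_on with
  | empty => simp
  | insert i t hi ih =>
    rw [Finset.sum_insert hi, Finset.sum_insert hi, ← ih, LocalizedModule.mk_add_mk, ← smul_add,
      LocalizedModule.mk_cancel_common_left]

theorem sum_decompose (a : A) : ∑ i : ZMod 2, (DirectSum.decompose 𝒜 a i : A) = a := by
  induction a using DirectSum.Decomposition.inductionOn 𝒜 with
  | zero => simp
  | @homogeneous i m =>
    rw [Finset.sum_eq_single i]
    · exact DirectSum.decompose_of_mem_same 𝒜 m.2
    · exact fun j _ hj => DirectSum.decompose_of_mem_ne 𝒜 m.2 hj.symm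
    · exact fun h => absurd (Finset.mem_univ i) h
  | add a b ha hb =>
    rw [DirectSum.decompose_add]
    simp only [DirectSum.add_apply, AddSubgroup.coe_add, Finset.sum_add_distrib, ha, hb]

theorem locDecompose_left_inv :
    (DirectSum.coeAddMonoidHom (locGrading 𝒜 S)).comp (locDecompose 𝒜 S) = .id _ := by
  ext x
  induction x with
  | _ a s =>
    simp only [locDecompose, AddMonoidHom.comp_apply, AddMonoidHom.finsetSum_apply, map_sum,
      DirectSum.coeAddMonoidHom_of, locProj_mk, AddMonoidHom.id_apply]
    rw [← mk_sum, sum_decompose]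

theorem locDecompose_right_inv :
    (locDecompose 𝒜 S).comp (DirectSum.coeAddMonoidHom (locGrading 𝒜 S)) = .id _ := by
  refine DirectSum.addHom_ext' fun j => AddMonoidHom.ext fun x => ?_
  obtain ⟨_, a, ha, s, rfl⟩ := x
  simp only [locDecompose, AddMonoidHom.comp_apply, AddMonoidHom.finsetSum_apply,
    DirectSum.coeAddMonoidHom_of, AddMonoidHom.id_apply]
  rw [Finset.sum_eq_single j]
  · congr 1
    refine Subtype.ext ?_
    rw [locProj_mk, DirectSum.decompose_of_mem_same 𝒜 ha]
  · intro i _ hij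
    have h : locProj 𝒜 S i (LocalizedModule.mk a s) = 0 := by
      refine Subtype.ext ?_
      rw [locProj_mk, DirectSum.decompose_of_mem_ne 𝒜 ha hij.symm, LocalizedModule.zero_mk]
      rfl
    rw [h, map_zero]
  · intro h
    exact absurd (Finset.mem_univ j) h

noncomputable instance locGradedRing : GradedRing (locGrading 𝒜 S) where
  toDecomposition := DirectSum.Decomposition.ofAddHom _ (locDecompose 𝒜 S)
    (locDecompose_left_inv 𝒜 S) (locDecompose_right_inv 𝒜 S)

instance locSuperCommutative : SuperCommutative (locGrading 𝒜 S) where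
  even_mul_comm := by
    rintro _ ⟨a, ha, s, rfl⟩ i _ ⟨b, hb, t, rfl⟩
    rw [LocalizedModule.mk_mul_mk, LocalizedModule.mk_mul_mk, even_comm 𝒜 ha, mul_comm s t]
  odd_mul_self := by
    rintro _ ⟨a, ha, s, rfl⟩
    rw [LocalizedModule.mk_mul_mk, SuperCommutative.odd_mul_self (𝒜 := 𝒜) a ha,
      LocalizedModule.zero_mk]

end Localization

/-! ## Krull super-dimension and regularity -/

section Regular

variable {R : Type u} [Ring R] (𝓡 : ZMod 2 → AddSubgroup R) [GradedRing 𝓡] [SuperCommutative 𝓡]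

/-- The ideal `Ann_{R₀}(z)`. -/
def evenAnn (z : R) : Ideal (𝓡 0) where
  carrier := {r | (r : R) * z = 0}
  zero_mem' := zero_mul z
  add_mem' {a b} ha hb := by
    change ((a : R) + b) * z = 0
    rw [add_mul, show (a : R) * z = 0 from ha, show (b : R) * z = 0 from hb, add_zero]
  smul_mem' c a ha := by
    change ((c : R) * a) * z = 0
    rw [mul_assoc, show (a : R) * z = 0 from ha, mul_zero]

/-- Odd elements `y₁, …, yₛ` form a system of odd parameters if
`Kdim (R₀) = Kdim (R₀ / Ann_{R₀}(y₁ ⋯ yₛ))`. -/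
def IsOddParameterSystem {s : ℕ} (y : Fin s → R) : Prop :=
  (∀ i, y i ∈ 𝓡 1) ∧
    ringKrullDim (𝓡 0) = ringKrullDim (𝓡 0 ⧸ evenAnn 𝓡 (List.ofFn y).prod)

/-- The even Krull dimension of `R`. -/
noncomputable def evenKrullDim : WithBot ℕ∞ := ringKrullDim (𝓡 0)

/-- The odd Krull dimension of `R`: the largest length of a system of odd parameters. -/
noncomputable def oddKrullDim : ℕ∞ :=
  ⨆ (s : ℕ) (_ : ∃ y : Fin s → R, IsOddParameterSystem 𝓡 y), (s : ℕ∞)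

variable (𝔪 : HomogeneousIdeal 𝓡)

/-- The residue ring `R₀ / 𝔪₀`; for a maximal super-ideal `𝔪` this is the field `R / 𝔪`. -/
abbrev Residue : Type u := 𝓡 0 ⧸ evenPart 𝓡 𝔪

/-- The component `𝔪ᵢ = 𝔪 ∩ Rᵢ`, as an `R₀`-module. -/
def idealComponent (i : ZMod 2) : Submodule (𝓡 0) R :=
  𝔪.toIdeal.restrictScalars (𝓡 0) ⊓ component 𝓡 i

/-- The component of degree `i` of `𝔪 / 𝔪²`. -/
def Cotangent (i : ZMod 2) : Type u :=
  ↥(idealComponent 𝓡 𝔪 i) ⧸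
    Submodule.submoduleOf ((𝔪.toIdeal ^ 2).restrictScalars (𝓡 0)) (idealComponent 𝓡 𝔪 i)

instance cotangentAddCommGroup (i : ZMod 2) : AddCommGroup (Cotangent 𝓡 𝔪 i) :=
  Submodule.Quotient.addCommGroup
    (Submodule.submoduleOf ((𝔪.toIdeal ^ 2).restrictScalars (𝓡 0)) (idealComponent 𝓡 𝔪 i))

instance cotangentEvenModule (i : ZMod 2) : Module (𝓡 0) (Cotangent 𝓡 𝔪 i) :=
  Submodule.Quotient.module
    (Submodule.submoduleOf ((𝔪.toIdeal ^ 2).restrictScalars (𝓡 0)) (idealComponent 𝓡 𝔪 i))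

theorem cotangent_isTorsionBySet (i : ZMod 2) :
    Module.IsTorsionBySet (𝓡 0) (Cotangent 𝓡 𝔪 i) (evenPart 𝓡 𝔪) := by
  rintro a ⟨r, hr⟩
  obtain ⟨x, rfl⟩ := Submodule.Quotient.mk_surjective _ a
  refine (Submodule.Quotient.mk_eq_zero _ (x := r • x)).2 ?_
  change (r : R) * (x : R) ∈ 𝔪.toIdeal ^ 2
  have h := Ideal.mul_mem_mul (I := 𝔪.toIdeal) (J := 𝔪.toIdeal) hr x.2.1
  rw [Submodule.pow_succ, Submodule.pow_one]
  exact h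

/-- `(𝔪 / 𝔪²)ᵢ` is a module over the residue ring. -/
instance cotangentModule (i : ZMod 2) : Module (Residue 𝓡 𝔪) (Cotangent 𝓡 𝔪 i) :=
  (cotangent_isTorsionBySet 𝓡 𝔪 i).module

/-- The dimension of the super-vector space `𝔪 / 𝔪²` in degree `i`. -/
noncomputable def cotangentDim (i : ZMod 2) : ℕ∞ :=
  Cardinal.toENat (Module.rank (Residue 𝓡 𝔪) (Cotangent 𝓡 𝔪 i))

/-- `R` is local with maximal super-ideal `𝔪`: it is the unique super-ideal such that `R / 𝔪` is
a field, which is the meaning of `𝔪.toIdeal.IsMaximal`. -/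
def IsLocalWith : Prop :=
  ∀ 𝔫 : HomogeneousIdeal 𝓡, 𝔫.toIdeal.IsMaximal ↔ 𝔫 = 𝔪

/-- A local super-ring `R` is regular if `Ksdim R = sdim (𝔪 / 𝔪²)`, where `𝔪` is its maximal
super-ideal. -/
def IsRegularLocal : Prop :=
  ∃ 𝔪 : HomogeneousIdeal 𝓡, IsLocalWith 𝓡 𝔪 ∧
    evenKrullDim 𝓡 = (cotangentDim 𝓡 𝔪 0 : WithBot ℕ∞) ∧ oddKrullDim 𝓡 = cotangentDim 𝓡 𝔪 1

/-- A super-ring is regular if its localizations at all prime super-ideals are regular local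
super-rings. -/
def IsRegular : Prop :=
  ∀ (𝔭 : HomogeneousIdeal 𝓡) [𝔭.toIdeal.IsPrime],
    IsRegularLocal (locGrading 𝓡 (evenCompl 𝓡 𝔭))

end Regular

end SuperRing

/-! Write `I = I_A` and `B = A/I`. Odd elements square to zero, so they lie in every prime
super-ideal, and the prime super-ideals of `A` are the preimages of the primes `P` of `B`. Both
sides of the equivalence reduce, prime by prime, to the regularity of `B_P` together with one
condition on odd elements, `HasFreeOddGeneratorsAt`: some odd `a₁, …, aₙ` generate `A₁` after
inverting an element outside `P`, and every even `c` killing `a₁⋯aₙ` falls into `I` after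
multiplication by an element outside `P`.

Regularity (`isRegularLocal_iff`). In a local `R` with `R₀` Noetherian and `R₁` finite over it,
`I_R` is nilpotent, so `R₀` and the body have the same dimension. The even cotangent space is that
of the body. The odd one has dimension `s`, the minimal number of generators `zᵢ` of `R₁` over `R₀`.
Regularity thus says that the body is a regular local ring and that the odd dimension is `s`. A
product of `s` odd elements is a multiple of `z₁⋯zₛ`, so odd dimension `s` forces `R₀/Ann(z₁⋯zₛ)` to
keep the full dimension. The body is a domain (`IsRegularLocalRing.isDomain`), so any nonzero
element in the image of the annihilator would lower the dimension: the annihilator lies in `I_R`.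
Conversely, an annihilator inside `I_R` is nil and does not change the dimension.

From generators to (ii) and (iii). Take a relation modulo `I^(k+1)` among the `k`-fold products of
the `aᵢ` and multiply it by a complementary product. One term survives, `± c a₁⋯aₙ`, and it lies in
`I^(n+1)`, which vanishes locally; hence `c` is locally in `I`
(`exists_mul_mem_oddIdeal_of_sum_mem`). For `k = 1` this makes `I/I²` locally free; for all `k` it
makes `λ` injective. Surjectivity of `λ` is automatic.

From (ii) and (iii) to generators (`hasFreeOddGeneratorsAt_of_projective`). Lift a local basis of
`I/I²` to odd elements. Nakayama for a nilpotent ideal shows that they generate. If `c` kills their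
product, injectivity of `λ` kills `c` times the top wedge, and a determinant shows that the image of
`c` in `B` vanishes locally. -/

/-! ### Commutative algebra: regular local rings are domains; dimension modulo nilpotents. -/

section RegularLocalDomain

open IsLocalRing

/-- If `x ∈ 𝔪 ∖ 𝔪²` then `𝔪` is generated by `x` and `edim R - 1` further elements. -/
theorem IsLocalRing.exists_maximalIdeal_eq_span_insert {R : Type*} [CommRing R] [IsLocalRing R]
    [IsNoetherianRing R] {n : ℕ} (hn : (maximalIdeal R).spanFinrank = n + 1) {x : R}
    (hx : x ∈ maximalIdeal R) (hx2 : x ∉ maximalIdeal R ^ 2) :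
    ∃ y : Fin n → R, maximalIdeal R = Ideal.span (insert x (Set.range y)) := by
  rw [spanFinrank_maximalIdeal_eq_finrank_cotangentSpace] at hn
  let v : CotangentSpace R := (maximalIdeal R).toCotangent ⟨x, hx⟩
  have hv : v ≠ 0 := fun h => hx2 ((Ideal.toCotangent_eq_zero _ _).1 h)
  let W := Submodule.span (ResidueField R) {v}
  have hW : Module.finrank (ResidueField R) (CotangentSpace R ⧸ W) = n := by
    have h := Submodule.finrank_quotient_add_finrank W
    rw [finrank_span_singleton hv, hn] at h
    omega
  let b := Module.finBasisOfFinrankEq _ _ hW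
  have hlift : ∀ i, ∃ y : maximalIdeal R, W.mkQ ((maximalIdeal R).toCotangent y) = b i := by
    intro i
    obtain ⟨c, hc⟩ := W.mkQ_surjective (b i)
    obtain ⟨y, rfl⟩ := (maximalIdeal R).toCotangent_surjective c
    exact ⟨y, hc⟩
  choose y hy using hlift
  have hle : Ideal.span (insert x (Set.range fun i => (y i : R))) ≤ maximalIdeal R := by
    rw [Ideal.span_le]
    rintro _ (rfl | ⟨i, rfl⟩)
    exacts [hx, (y i).2]
  refine ⟨fun i => y i, le_antisymm ?_ hle⟩
  -- By Nakayama it suffices to generate modulo `𝔪²`: the coordinates of `w` in the quotient by the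
  -- line of `x` give the `y`-part, and what remains is a multiple of `x`.
  refine Submodule.le_of_le_smul_of_le_jacobson_bot (I := maximalIdeal R)
    (maximalIdeal R).fg_of_isNoetherianRing (maximalIdeal_le_jacobson _) fun w hw => ?_
  let w' : maximalIdeal R := ⟨w, hw⟩
  choose r hr using fun i =>
    IsLocalRing.residue_surjective (b.repr (W.mkQ ((maximalIdeal R).toCotangent w')) i)
  have h1 : W.mkQ ((maximalIdeal R).toCotangent (w' - ∑ i, r i • y i)) = 0 := by
    rw [map_sub, map_sub, map_sum, map_sum, sub_eq_zero]
    conv_lhs => rw [← b.sum_repr (W.mkQ ((maximalIdeal R).toCotangent w'))]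
    refine Finset.sum_congr rfl fun i _ => ?_
    rw [← hr, ← hy, map_smul]
    rfl
  rw [Submodule.mkQ_apply, Submodule.Quotient.mk_eq_zero] at h1
  obtain ⟨c, hc⟩ := Submodule.mem_span_singleton.1 h1
  obtain ⟨c, rfl⟩ := IsLocalRing.residue_surjective c
  have h2 : (maximalIdeal R).toCotangent (w' - ∑ i, r i • y i - c • ⟨x, hx⟩) = 0 := by
    rw [map_sub, ← hc, map_smul, sub_eq_zero]
    rfl
  rw [Ideal.toCotangent_eq_zero] at h2
  refine Submodule.mem_sup.2 ⟨∑ i, r i * y i + c * x, ?_, _, ?_, add_sub_cancel _ w⟩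
  · refine add_mem (sum_mem fun i _ => Ideal.mul_mem_left _ _ (Ideal.subset_span ?_))
      (Ideal.mul_mem_left _ _ (Ideal.subset_span (Set.mem_insert _ _)))
    exact Set.mem_insert_of_mem _ ⟨i, rfl⟩
  · rw [smul_eq_mul, ← pow_two]
    convert h2 using 1
    simp [w', sub_sub]

/-- Induction on the embedding dimension. Prime avoidance yields `x ∈ 𝔪` outside `𝔪²` and outside
all minimal primes. Then `R/(x)` is regular of embedding dimension one less, so `(x)` is prime by
induction. A minimal prime `q ≤ (x)` does not contain `x`, hence `q = xq`, and Nakayama gives `q =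
0`. -/
theorem IsRegularLocalRing.isDomain (R : Type*) [CommRing R] [IsRegularLocalRing R] :
    IsDomain R := by
  obtain ⟨n, hn⟩ : ∃ n, (maximalIdeal R).spanFinrank = n := ⟨_, rfl⟩
  induction n generalizing R with
  | zero =>
    rw [Submodule.spanFinrank_eq_zero_iff_eq_bot (maximalIdeal R).fg_of_isNoetherianRing] at hn
    exact (IsLocalRing.isField_iff_maximalIdeal_eq.2 hn).isDomain
  | succ n ih =>
    have hdim : ringKrullDim R = (n + 1 : ℕ) := by
      rw [← hn, IsRegularLocalRing.spanFinrank_maximalIdeal]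
    have hm : maximalIdeal R ≠ ⊥ := fun h => by
      rw [h, Submodule.spanFinrank_bot] at hn
      omega
    have hfin := minimalPrimes.finite_of_isNoetherianRing R
    obtain ⟨x, hx, hx2⟩ : ∃ x ∈ maximalIdeal R, x ∉ maximalIdeal R ^ 2 ∧
        ∀ q ∈ minimalPrimes R, x ∉ q := by
      by_contra! hcon
      have hsub : (maximalIdeal R : Set R) ⊆
          ⋃ i ∈ ((insert (maximalIdeal R ^ 2) hfin.toFinset : Finset (Ideal R)) : Set (Ideal R)),
            ((id i : Ideal R) : Set R) := by
        intro x hx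
        by_cases h : x ∈ maximalIdeal R ^ 2
        · exact Set.mem_biUnion (by simp) h
        · obtain ⟨q, hq, hxq⟩ := hcon x hx h
          exact Set.mem_biUnion (by simp [hq]) hxq
      -- Prime avoidance allows two members of the family not to be prime; `𝔪²` fills both places.
      rw [Ideal.subset_union_prime (maximalIdeal R ^ 2) (maximalIdeal R ^ 2)] at hsub
      · obtain ⟨q, hq, hle⟩ := hsub
        rcases Finset.mem_insert.1 hq with rfl | hq
        · refine hm (Submodule.eq_bot_of_le_smul_of_le_jacobson_bot (maximalIdeal R) _
            (maximalIdeal R).fg_of_isNoetherianRing ?_ (maximalIdeal_le_jacobson _))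
          rw [smul_eq_mul, ← pow_two]
          exact hle
        · rw [Set.Finite.mem_toFinset] at hq
          have hqp := hq.1.1
          have h1 : maximalIdeal R = q := le_antisymm hle (le_maximalIdeal hqp.ne_top)
          have h2 : (maximalIdeal R).height = 0 := by
            rw [Ideal.height_eq_zero_iff, h1]
            exact hq
          have h3 := maximalIdeal_height_eq_ringKrullDim (R := R)
          rw [h2, hdim] at h3
          have h4 : (0 : ℕ∞) = (n + 1 : ℕ) := WithBot.coe_injective h3
          exact absurd (Nat.cast_injective h4) (by omega)
      · intro i hi h1 _
        have := (Finset.mem_insert.1 hi).resolve_left h1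
        exact (hfin.mem_toFinset.1 this).1.1
    obtain ⟨hx2, hxq⟩ := hx2
    obtain ⟨y, hy⟩ := exists_maximalIdeal_eq_span_insert hn hx hx2
    have hxtop : Ideal.span {x} ≠ ⊤ := by
      rw [Ne, Ideal.span_singleton_eq_top]
      exact hx
    have : Nontrivial (R ⧸ Ideal.span {x}) := Ideal.Quotient.nontrivial_iff.2 hxtop
    have hloc : IsLocalRing (R ⧸ Ideal.span {x}) :=
      IsLocalRing.of_surjective' _ Ideal.Quotient.mk_surjective
    have hspan : (maximalIdeal (R ⧸ Ideal.span {x})).spanFinrank ≤ n := by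
      have h1 : maximalIdeal (R ⧸ Ideal.span {x}) =
          Ideal.span (Set.range fun i => Ideal.Quotient.mk (Ideal.span {x}) (y i)) := by
        have h2 : maximalIdeal (R ⧸ Ideal.span {x}) =
            (maximalIdeal R).map (Ideal.Quotient.mk (Ideal.span {x})) := by
          have : IsLocalHom (Ideal.Quotient.mk (Ideal.span {x})) :=
            .of_surjective _ Ideal.Quotient.mk_surjective
          exact (IsLocalRing.map_maximalIdeal_of_surjective _ Ideal.Quotient.mk_surjective).symm
        rw [h2, hy, Ideal.map_span, Set.image_insert_eq, Ideal.Quotient.mk_singleton_self,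
          ← Set.range_comp]
        exact Submodule.span_insert_zero
      rw [h1]
      refine (Submodule.spanFinrank_span_le_ncard_of_finite (Set.finite_range _)).trans ?_
      rw [← Set.image_univ]
      exact (Set.ncard_image_le Set.finite_univ).trans (by simp)
    -- One element lowers the dimension by at most one, which meets the bound `n` on the embedding
    -- dimension.
    have hle : (n : WithBot ℕ∞) ≤ ringKrullDim (R ⧸ Ideal.span {x}) := by
      have h := ringKrullDim_le_ringKrullDim_quotient_add_card {x}
        (by simpa [IsLocalRing.ringJacobson_eq_maximalIdeal] using hx)
      rw [hdim] at h
      rw [Finset.coe_singleton, Finset.card_singleton, Nat.cast_add, Nat.cast_one] at h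
      exact ENat.WithBot.add_le_add_one_right_iff.1 h
    have hreg : IsRegularLocalRing (R ⧸ Ideal.span {x}) :=
      .of_spanFinrank_maximalIdeal_le _ (le_trans (by exact_mod_cast hspan) hle)
    have hprime : (Ideal.span {x}).IsPrime := by
      rw [← Ideal.Quotient.isDomain_iff_prime]
      refine ih _ (le_antisymm hspan ?_)
      rw [← hreg.spanFinrank_maximalIdeal] at hle
      exact_mod_cast hle
    obtain ⟨q, hq, hqx⟩ := Ideal.exists_minimalPrimes_le (bot_le (a := Ideal.span {x}))
    have hqp : q.IsPrime := hq.1.1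
    have hq0 : q = ⊥ := by
      refine Submodule.eq_bot_of_le_smul_of_le_jacobson_bot (maximalIdeal R) _
        q.fg_of_isNoetherianRing (fun z hz => ?_) (maximalIdeal_le_jacobson _)
      obtain ⟨c, rfl⟩ := Ideal.mem_span_singleton'.1 (hqx hz)
      have hc : c ∈ q := (hqp.mem_or_mem hz).resolve_right (hxq q hq)
      rw [mul_comm]
      exact Ideal.mul_mem_mul hx hc
    rw [hq0] at hqp
    exact IsDomain.of_bot_isPrime R

/-- Every prime contains the nilradical, so the same primes contain `I` and `J`. -/
theorem ringKrullDim_quotient_eq_of_le_nilradical_sup {R : Type*} [CommRing R] {I J : Ideal R}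
    (hIJ : I ≤ J) (h : J ≤ I ⊔ nilradical R) : ringKrullDim (R ⧸ I) = ringKrullDim (R ⧸ J) := by
  rw [ringKrullDim_quotient, ringKrullDim_quotient]
  suffices PrimeSpectrum.zeroLocus (I : Set R) = PrimeSpectrum.zeroLocus (J : Set R) by rw [this]
  refine le_antisymm (fun p hp => ?_) (PrimeSpectrum.zeroLocus_anti_mono_ideal hIJ)
  refine h.trans (sup_le (show I ≤ p.asIdeal from hp) fun x hx => ?_)
  exact nilradical_le_prime p.asIdeal hx

end RegularLocalDomain

namespace SuperRing

/-! ### Super-rings: Noetherian components, nilpotency of the odd ideal, products of odd elements.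
-/

section Structure

set_option linter.unusedSectionVars false

variable {A : Type u} [Ring A] (𝒜 : ZMod 2 → AddSubgroup A) [GradedRing 𝒜]

theorem coe_decompose_mul_of_right_mem {i : ZMod 2} (r : A) {x : A} (hx : x ∈ 𝒜 i) :
    (DirectSum.decompose 𝒜 (r * x) i : A) = (DirectSum.decompose 𝒜 r 0 : A) * x := by
  have h := DirectSum.coe_decompose_mul_add_of_right_mem 𝒜 (i := 0) (a := r) hx
  rwa [zero_add] at h

theorem coe_decompose_zero_add_one (x : A) :
    (DirectSum.decompose 𝒜 x 0 : A) + (DirectSum.decompose 𝒜 x 1 : A) = x := by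
  obtain ⟨e, he, o, ho, rfl⟩ := exists_even_add_odd 𝒜 x
  simp [DirectSum.decompose_of_mem_same 𝒜 he, DirectSum.decompose_of_mem_same 𝒜 ho,
    DirectSum.decompose_of_mem_ne 𝒜 he (show (0 : ZMod 2) ≠ 1 by decide),
    DirectSum.decompose_of_mem_ne 𝒜 ho (show (1 : ZMod 2) ≠ 0 by decide)]

theorem decompose_zero_mul (x y : A) :
    (DirectSum.decompose 𝒜 (x * y) 0 : A) =
      (DirectSum.decompose 𝒜 x 0 : A) * (DirectSum.decompose 𝒜 y 0 : A) +
      (DirectSum.decompose 𝒜 x 1 : A) * (DirectSum.decompose 𝒜 y 1 : A) := by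
  conv_lhs => rw [← coe_decompose_zero_add_one 𝒜 y, mul_add, DirectSum.decompose_add,
    DirectSum.add_apply, AddSubgroup.coe_add]
  rw [DirectSum.coe_decompose_mul_of_right_mem_zero 𝒜 (SetLike.coe_mem _)]
  congr 1
  exact DirectSum.coe_decompose_mul_add_of_right_mem 𝒜 (i := 1) (j := 1) (SetLike.coe_mem _)

theorem decompose_one_mul (x y : A) :
    (DirectSum.decompose 𝒜 (x * y) 1 : A) =
      (DirectSum.decompose 𝒜 x 1 : A) * (DirectSum.decompose 𝒜 y 0 : A) +
      (DirectSum.decompose 𝒜 x 0 : A) * (DirectSum.decompose 𝒜 y 1 : A) := by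
  conv_lhs => rw [← coe_decompose_zero_add_one 𝒜 y, mul_add, DirectSum.decompose_add,
    DirectSum.add_apply, AddSubgroup.coe_add]
  rw [DirectSum.coe_decompose_mul_of_right_mem_zero 𝒜 (SetLike.coe_mem _),
    coe_decompose_mul_of_right_mem 𝒜 _ (SetLike.coe_mem _)]

variable [SuperCommutative 𝒜]

/-- For `x` of degree `i`, the degree `i` part of `r x` is `r₀ x`. Thus `N` is recovered from the
ideal that it generates. -/
theorem decompose_mem_of_mem_span {i : ZMod 2} {N : Submodule (𝒜 0) A} (hN : N ≤ component 𝒜 i)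
    {x : A} (hx : x ∈ Ideal.span (N : Set A)) : (DirectSum.decompose 𝒜 x i : A) ∈ N := by
  suffices ∀ r : A, (DirectSum.decompose 𝒜 (r * x) i : A) ∈ N by simpa using this 1
  induction hx using Submodule.span_induction with
  | mem x hx =>
    intro r
    rw [coe_decompose_mul_of_right_mem 𝒜 r (hN hx)]
    exact N.smul_mem (DirectSum.decompose 𝒜 r 0) hx
  | zero => simp
  | add x y _ _ hx hy =>
    intro r
    rw [mul_add, DirectSum.decompose_add, DirectSum.add_apply, AddSubgroup.coe_add]
    exact add_mem (hx r) (hy r)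
  | smul s x _ hx =>
    intro r
    rw [smul_eq_mul, ← mul_assoc]
    exact hx _

variable {𝒜} in
/-- The components of a Noetherian super-ring are Noetherian modules over its even part. -/
theorem IsNoetherianSuperRing.isNoetherian_component (hA : IsNoetherianSuperRing 𝒜) (i : ZMod 2) :
    IsNoetherian (𝒜 0) (component 𝒜 i) := by
  have : WellFoundedGT (HomogeneousIdeal 𝒜) := hA
  rw [isNoetherian_iff']
  let F : Submodule (𝒜 0) (component 𝒜 i) → HomogeneousIdeal 𝒜 := fun N =>
    ⟨Ideal.span (N.map (component 𝒜 i).subtype : Set A), Ideal.homogeneous_span 𝒜 _ (by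
      rintro _ ⟨x, _, rfl⟩
      exact ⟨i, x.2⟩)⟩
  have hF : ∀ N (x : component 𝒜 i), (x : A) ∈ (F N).toIdeal → x ∈ N := by
    intro N x hx
    have h := decompose_mem_of_mem_span 𝒜 (Submodule.map_subtype_le _ _) hx
    rw [DirectSum.decompose_of_mem_same 𝒜 x.2] at h
    obtain ⟨y, hy, hyx⟩ := h
    rwa [Subtype.ext hyx] at hy
  have hF' : ∀ N (x : component 𝒜 i), x ∈ N → (x : A) ∈ (F N).toIdeal := fun N x hx =>
    Ideal.subset_span ⟨x, hx, rfl⟩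
  -- Distinct submodules generate distinct super-ideals, so the chain condition is inherited.
  refine StrictMono.wellFoundedGT (f := F) (Monotone.strictMono_of_injective ?_ ?_)
  · intro N N' h
    exact Ideal.span_mono (Set.image_mono h)
  · intro N N' h
    ext x
    exact ⟨fun hx => hF _ _ (h ▸ hF' _ _ hx), fun hx => hF _ _ (h ▸ hF' _ _ hx)⟩

variable {𝒜} in
theorem IsNoetherianSuperRing.isNoetherianRing_even (hA : IsNoetherianSuperRing 𝒜) :
    IsNoetherianRing (𝒜 0) := by
  have := hA.isNoetherian_component 0
  let e : 𝒜 0 ≃ₗ[𝒜 0] component 𝒜 0 :=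
    { toFun := fun x => x
      invFun := fun x => x
      map_add' := fun _ _ => rfl
      map_smul' := fun _ _ => rfl
      left_inv := fun _ => rfl
      right_inv := fun _ => rfl }
  exact isNoetherian_of_linearEquiv e.symm

/-! ### The projection of the even part to the body -/

/-- The ring homomorphism `A₀ → A / I_A`. -/
def evenToBody : 𝒜 0 →+* Body 𝒜 :=
  (Ideal.Quotient.mk (oddIdeal 𝒜)).comp (algebraMap (𝒜 0) A)

theorem evenToBody_surjective : Function.Surjective (evenToBody 𝒜) := body_exists_even 𝒜

theorem evenToBody_eq_zero_iff {x : 𝒜 0} : evenToBody 𝒜 x = 0 ↔ (x : A) ∈ oddIdeal 𝒜 :=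
  Ideal.Quotient.eq_zero_iff_mem

theorem odd_mem_oddIdeal {x : A} (hx : x ∈ 𝒜 1) : x ∈ oddIdeal 𝒜 := Ideal.subset_span hx

theorem mk_eq_evenToBody (x : A) :
    Ideal.Quotient.mk (oddIdeal 𝒜) x = evenToBody 𝒜 (DirectSum.decompose 𝒜 x 0) := by
  conv_lhs => rw [← coe_decompose_zero_add_one 𝒜 x, map_add,
    Ideal.Quotient.eq_zero_iff_mem.2 (odd_mem_oddIdeal 𝒜 (SetLike.coe_mem _)), add_zero]
  rfl

/-- The even part of `r x` with `x` odd is `r₁ x`, a product of two odd elements. The multiplier `r`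
makes the induction over the span go through. -/
theorem decompose_zero_mem_sq {x : A} (hx : x ∈ oddIdeal 𝒜) :
    (DirectSum.decompose 𝒜 x 0 : A) ∈ oddIdeal 𝒜 ^ 2 := by
  suffices ∀ r : A, (DirectSum.decompose 𝒜 (r * x) 0 : A) ∈ oddIdeal 𝒜 ^ 2 by simpa using this 1
  induction hx using Submodule.span_induction with
  | mem x hx =>
    intro r
    rw [decompose_zero_mul, DirectSum.decompose_of_mem_ne 𝒜 hx (show (1 : ZMod 2) ≠ 0 by decide),
      DirectSum.decompose_of_mem_same 𝒜 hx, mul_zero, zero_add, Ideal.IsTwoSided.pow_succ,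
      Submodule.pow_one]
    exact Ideal.mul_mem_mul (odd_mem_oddIdeal 𝒜 (SetLike.coe_mem _)) (odd_mem_oddIdeal 𝒜 hx)
  | zero => simp
  | add x y _ _ hx hy =>
    intro r
    rw [mul_add, DirectSum.decompose_add, DirectSum.add_apply, AddSubgroup.coe_add]
    exact add_mem (hx r) (hy r)
  | smul s x _ hx =>
    intro r
    rw [smul_eq_mul, ← mul_assoc]
    exact hx _

/-! ### Products of odd elements -/

theorem odd_prod_perm {ι : Type*} {a : ι → A} (ha : ∀ i, a i ∈ 𝒜 1) {l l' : List ι}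
    (h : l.Perm l') : (l.map a).prod = (l'.map a).prod ∨ (l.map a).prod = -(l'.map a).prod := by
  induction h with
  | nil => exact Or.inl rfl
  | cons x _ ih =>
    simp only [List.map_cons, List.prod_cons]
    rcases ih with ih | ih <;> rw [ih]
    · exact Or.inl rfl
    · exact Or.inr (mul_neg _ _)
  | swap x y l =>
    right
    simp only [List.map_cons, List.prod_cons]
    rw [← mul_assoc, ← mul_assoc, odd_anticomm 𝒜 (ha y) (ha x), neg_mul]
  | trans _ _ h1 h2 =>
    rcases h1 with h1 | h1 <;> rcases h2 with h2 | h2 <;> rw [h1, h2] <;> simp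

theorem odd_prod_eq_zero {ι : Type*} {a : ι → A} (ha : ∀ i, a i ∈ 𝒜 1) {l : List ι}
    (hl : ¬ l.Nodup) : (l.map a).prod = 0 := by
  classical
  obtain ⟨x, hx⟩ := List.exists_duplicate_iff_not_nodup.2 hl
  obtain ⟨l', hl'⟩ := (List.duplicate_iff_sublist.1 hx).exists_perm_append
  have h0 : (([x, x] ++ l').map a).prod = 0 := by
    simp [← mul_assoc, SuperCommutative.odd_mul_self (𝒜 := 𝒜) _ (ha x)]
  rcases odd_prod_perm 𝒜 ha hl' with h | h <;> rw [h, h0]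
  exact neg_zero

/-- The product of odd elements, as an alternating map over the even part. -/
noncomputable def oddProduct (n : ℕ) : component 𝒜 1 [⋀^Fin n]→ₗ[𝒜 0] A :=
  (ExteriorAlgebra.lift (𝒜 0) ⟨(component 𝒜 1).subtype,
    fun m => SuperCommutative.odd_mul_self (𝒜 := 𝒜) _ m.2⟩).toLinearMap.compAlternatingMap
    (ExteriorAlgebra.ιMulti (𝒜 0) n)

theorem oddProduct_apply {n : ℕ} (v : Fin n → component 𝒜 1) :
    oddProduct 𝒜 n v = (List.ofFn fun i => (v i : A)).prod := by
  simp [oddProduct, ExteriorAlgebra.ιMulti_apply, map_list_prod, List.map_ofFn, Function.comp_def]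

/-- A product of linear combinations of odd elements `aᵢ` is a linear combination of the products
of the `aᵢ` with increasing indices. -/
theorem prod_mem_span_prod {s n : ℕ} {a : Fin s → A} (ha : ∀ i, a i ∈ 𝒜 1) {v : Fin n → A}
    (hv : ∀ i, v i ∈ Submodule.span (𝒜 0) (Set.range a)) :
    (List.ofFn v).prod ∈ Submodule.span (𝒜 0)
      (Set.range fun f : Fin n ↪o Fin s => (List.ofFn fun i => a (f i)).prod) := by
  set N := Submodule.span (𝒜 0) (Set.range a) with hN
  have hNc : N ≤ component 𝒜 1 := Submodule.span_le.2 (by rintro _ ⟨i, rfl⟩; exact ha i)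
  let a' : Fin s → N := fun i => ⟨a i, Submodule.subset_span ⟨i, rfl⟩⟩
  have ha' : Submodule.span (𝒜 0) (Set.range a') = ⊤ :=
    (Submodule.span_range_subtype_eq_top_iff N (s := a) _).2 rfl
  -- The product factors through the exterior power of `N`, which is spanned by the increasing
  -- wedges of any spanning family; no freeness is needed.
  let g : ⋀[𝒜 0]^n N →ₗ[𝒜 0] A := exteriorPower.alternatingMapLinearEquiv
    ((oddProduct 𝒜 n).compLinearMap (Submodule.inclusion hNc))
  have hg : ∀ w : Fin n → N, g (exteriorPower.ιMulti (𝒜 0) n w) =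
      (List.ofFn fun i => (w i : A)).prod := by
    intro w
    rw [exteriorPower.alternatingMapLinearEquiv_apply_ιMulti]
    exact oddProduct_apply 𝒜 _
  have h1 : exteriorPower.ιMulti (𝒜 0) n (fun i => (⟨v i, hv i⟩ : N)) ∈
      Submodule.span (𝒜 0) (Set.range (exteriorPower.ιMulti_family (𝒜 0) n a')) := by
    rw [exteriorPower.ιMulti_family_span_of_span (𝒜 0) ha']
    trivial
  have h2 := Submodule.mem_map_of_mem (f := g) h1
  rw [hg, Submodule.map_span, ← Set.range_comp] at h2
  refine Submodule.span_mono ?_ h2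
  rintro _ ⟨J, rfl⟩
  exact ⟨Set.powersetCard.ofFinEmbEquiv.symm J,
    (hg (a' ∘ Set.powersetCard.ofFinEmbEquiv.symm J)).symm⟩

/-- There are no increasing maps `Fin n → Fin s` when `s < n`. -/
theorem prod_eq_zero_of_mem_span {s n : ℕ} (hsn : s < n) {a : Fin s → A} (ha : ∀ i, a i ∈ 𝒜 1)
    {v : Fin n → A} (hv : ∀ i, v i ∈ Submodule.span (𝒜 0) (Set.range a)) :
    (List.ofFn v).prod = 0 := by
  have h := prod_mem_span_prod 𝒜 ha hv
  have : IsEmpty (Fin n ↪o Fin s) := ⟨fun f => by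
    have := Fintype.card_le_of_embedding f.toEmbedding
    simp at this
    omega⟩
  rwa [Set.range_eq_empty, Submodule.span_empty, Submodule.mem_bot] at h

theorem _root_.Fin.orderEmbedding_self_eq {s : ℕ} (f : Fin s ↪o Fin s) (i : Fin s) : f i = i := by
  have hf : Function.Surjective f := Finite.surjective_of_injective f.injective
  let e : Fin s ≃o Fin s := RelIso.ofSurjective f hf
  have : e = OrderIso.refl _ := Subsingleton.elim _ _
  exact DFunLike.congr_fun this i

/-- The identity is the only increasing self-map of `Fin s`, so a single product spans. -/
theorem prod_eq_smul_of_mem_span {s : ℕ} {a : Fin s → A} (ha : ∀ i, a i ∈ 𝒜 1)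
    {v : Fin s → A} (hv : ∀ i, v i ∈ Submodule.span (𝒜 0) (Set.range a)) :
    ∃ c : 𝒜 0, (List.ofFn v).prod = (c : A) * (List.ofFn a).prod := by
  have h := prod_mem_span_prod 𝒜 ha hv
  have h1 : (Set.range fun f : Fin s ↪o Fin s => (List.ofFn fun i => a (f i)).prod) =
      {(List.ofFn a).prod} := by
    ext x
    simp only [Fin.orderEmbedding_self_eq, Set.mem_range, Set.mem_singleton_iff]
    exact ⟨fun ⟨_, h⟩ => h.symm, fun h => ⟨RelEmbedding.refl _, h.symm⟩⟩
  rw [h1, Submodule.mem_span_singleton] at h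
  obtain ⟨c, hc⟩ := h
  exact ⟨c, hc.symm⟩

theorem oddIdeal_pow_le_span (n : ℕ) : oddIdeal 𝒜 ^ n ≤
    Ideal.span {x | ∃ v : Fin n → A, (∀ i, v i ∈ 𝒜 1) ∧ x = (List.ofFn v).prod} := by
  induction n with
  | zero =>
    rw [Submodule.pow_zero, Ideal.one_eq_top, top_le_iff, Ideal.eq_top_iff_one]
    exact Ideal.subset_span ⟨Fin.elim0, fun i => i.elim0, by simp⟩
  | succ n ih =>
    rw [Ideal.IsTwoSided.pow_succ, Ideal.mul_le]
    intro x hx y hy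
    replace hy := ih hy
    induction hy using Submodule.span_induction generalizing x with
    | mem y hy =>
      obtain ⟨v, hv, rfl⟩ := hy
      induction hx using Submodule.span_induction with
      | mem x hx =>
        refine Ideal.subset_span ⟨Fin.cons x v, fun i => ?_, by simp⟩
        cases i using Fin.cases with
        | zero => exact hx
        | succ i => exact hv i
      | zero => simp
      | add x y _ _ hx hy => rw [add_mul]; exact add_mem hx hy
      | smul r x _ hx => rw [smul_eq_mul, mul_assoc]; exact Ideal.mul_mem_left _ _ hx
    | zero => simp
    | add y z _ _ hy hz => rw [mul_add]; exact add_mem (hy x hx) (hz x hx)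
    | smul r y _ hy =>
      rw [smul_eq_mul, ← mul_assoc]
      exact hy _ ((oddIdeal_isTwoSided 𝒜).mul_mem_of_left r hx)

theorem pow_mul_prod (t : 𝒜 0) {n : ℕ} (v : Fin n → A) :
    ((t : A) ^ n) * (List.ofFn v).prod = (List.ofFn fun i => (t : A) * v i).prod := by
  induction n with
  | zero => simp
  | succ n ih =>
    rw [List.ofFn_succ, List.ofFn_succ, List.prod_cons, List.prod_cons, ← ih, pow_succ', mul_assoc,
      mul_assoc, ← mul_assoc _ (v 0), ← mul_assoc (v 0)]
    congr 2
    exact even_comm 𝒜 (t ^ n).2 (v 0)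

/-- If `t A₁` is contained in the span of `s` odd elements, then `tⁿ` annihilates `I_Aⁿ`
for `n > s`. -/
theorem pow_mul_eq_zero {s n : ℕ} (hsn : s < n) {a : Fin s → A} (ha : ∀ i, a i ∈ 𝒜 1) {t : 𝒜 0}
    (ht : ∀ x ∈ 𝒜 1, (t : A) * x ∈ Submodule.span (𝒜 0) (Set.range a)) {x : A}
    (hx : x ∈ oddIdeal 𝒜 ^ n) : (t : A) ^ n * x = 0 := by
  replace hx := oddIdeal_pow_le_span 𝒜 n hx
  induction hx using Submodule.span_induction with
  | mem x hx =>
    obtain ⟨v, hv, rfl⟩ := hx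
    rw [pow_mul_prod]
    exact prod_eq_zero_of_mem_span 𝒜 hsn ha fun i => ht _ (hv i)
  | zero => simp
  | add x y _ _ hx hy => rw [mul_add, hx, hy, add_zero]
  | smul r x _ hx =>
    have h : (t : A) ^ n * r = r * (t : A) ^ n := even_comm 𝒜 (t ^ n).2 r
    rw [smul_eq_mul, ← mul_assoc, h, mul_assoc, hx, mul_zero]

theorem exists_odd_generators [Module.Finite (𝒜 0) (component 𝒜 1)] :
    ∃ (s : ℕ) (a : Fin s → A), (∀ i, a i ∈ 𝒜 1) ∧
      ∀ x ∈ 𝒜 1, x ∈ Submodule.span (𝒜 0) (Set.range a) := by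
  obtain ⟨s, a, ha⟩ := Module.Finite.exists_fin (R := 𝒜 0) (M := component 𝒜 1)
  refine ⟨s, fun i => a i, fun i => (a i).2, fun x hx => ?_⟩
  have h : (⟨x, hx⟩ : component 𝒜 1) ∈ Submodule.span (𝒜 0) (Set.range a) := ha ▸ trivial
  have h2 := Submodule.mem_map_of_mem (f := (component 𝒜 1).subtype) h
  rwa [Submodule.map_span, ← Set.range_comp] at h2

theorem exists_oddIdeal_pow_eq_bot [Module.Finite (𝒜 0) (component 𝒜 1)] :
    ∃ n, oddIdeal 𝒜 ^ n = ⊥ := by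
  obtain ⟨s, a, ha, h⟩ := exists_odd_generators 𝒜
  refine ⟨s + 1, (Submodule.eq_bot_iff _).2 fun x hx => ?_⟩
  have := pow_mul_eq_zero 𝒜 (Nat.lt_succ_self s) ha (t := 1) (fun x hx => by
    rw [show ((1 : 𝒜 0) : A) = 1 from rfl, one_mul]; exact h x hx) hx
  rwa [show ((1 : 𝒜 0) : A) = 1 from rfl, one_pow, one_mul] at this

theorem pow_mem_oddIdeal_pow {x : A} (hx : x ∈ oddIdeal 𝒜) (n : ℕ) : x ^ n ∈ oddIdeal 𝒜 ^ n := by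
  induction n with
  | zero => rw [Submodule.pow_zero, Ideal.one_eq_top]; trivial
  | succ n ih =>
    rw [pow_succ', Ideal.IsTwoSided.pow_succ]
    exact Ideal.mul_mem_mul hx ih

theorem ker_evenToBody_le_nilradical [Module.Finite (𝒜 0) (component 𝒜 1)] :
    RingHom.ker (evenToBody 𝒜) ≤ nilradical (𝒜 0) := by
  intro x hx
  obtain ⟨n, hn⟩ := exists_oddIdeal_pow_eq_bot 𝒜
  have h := pow_mem_oddIdeal_pow 𝒜 ((evenToBody_eq_zero_iff 𝒜).1 hx) n
  rw [hn, Submodule.mem_bot] at h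
  exact ⟨n, Subtype.ext h⟩

theorem ringKrullDim_even_eq_body [Module.Finite (𝒜 0) (component 𝒜 1)] :
    ringKrullDim (𝒜 0) = ringKrullDim (Body 𝒜) := by
  rw [← ringKrullDim_eq_of_ringEquiv
    (RingHom.quotientKerEquivOfSurjective (evenToBody_surjective 𝒜)),
    ← ringKrullDim_quotient_eq_of_le_nilradical_sup (bot_le (a := RingHom.ker (evenToBody 𝒜)))]
  · exact (ringKrullDim_eq_of_ringEquiv (RingEquiv.quotientBot (𝒜 0))).symm
  · rw [bot_sup_eq]
    exact ker_evenToBody_le_nilradical 𝒜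

theorem isNoetherianRing_body [IsNoetherianRing (𝒜 0)] : IsNoetherianRing (Body 𝒜) :=
  isNoetherianRing_of_surjective _ _ _ (evenToBody_surjective 𝒜)

end Structure

/-! ### Local super-rings: cotangent dimensions and odd parameters in terms of the body. -/

section Local

set_option linter.unusedSectionVars false

variable {R : Type u} [Ring R] (𝓡 : ZMod 2 → AddSubgroup R) [GradedRing 𝓡] [SuperCommutative 𝓡]

/-- The super-ideal of `R` corresponding to an ideal of `R / I_R`. -/
def bodyComap (P : Ideal (Body 𝓡)) : HomogeneousIdeal 𝓡 where
  toSubmodule := P.comap (Ideal.Quotient.mk (oddIdeal 𝓡))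
  is_homogeneous' := by
    intro i x hx
    have h1 : (DirectSum.decompose 𝓡 x 1 : R) ∈ P.comap (Ideal.Quotient.mk (oddIdeal 𝓡)) := by
      rw [Ideal.mem_comap, Ideal.Quotient.eq_zero_iff_mem.2
        (odd_mem_oddIdeal 𝓡 (SetLike.coe_mem _))]
      exact zero_mem _
    have hi : ∀ k : ZMod 2, k = 0 ∨ k = 1 := by decide
    rcases hi i with rfl | rfl
    · rw [Ideal.mem_comap, mk_eq_evenToBody] at hx
      exact hx
    · exact h1

theorem mem_bodyComap {P : Ideal (Body 𝓡)} {x : R} :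
    x ∈ (bodyComap 𝓡 P).toIdeal ↔ Ideal.Quotient.mk (oddIdeal 𝓡) x ∈ P := Iff.rfl

theorem evenPart_bodyComap (P : Ideal (Body 𝓡)) :
    evenPart 𝓡 (bodyComap 𝓡 P) = P.comap (evenToBody 𝓡) := rfl

theorem oddIdeal_le_bodyComap (P : Ideal (Body 𝓡)) : oddIdeal 𝓡 ≤ (bodyComap 𝓡 P).toIdeal := by
  intro x hx
  rw [mem_bodyComap, Ideal.Quotient.eq_zero_iff_mem.2 hx]
  exact zero_mem _

instance bodyComap_isPrime (P : Ideal (Body 𝓡)) [hP : P.IsPrime] :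
    (bodyComap 𝓡 P).toIdeal.IsPrime where
  ne_top' h := hP.ne_top ((Ideal.eq_top_iff_one _).2
    (show (1 : R) ∈ (bodyComap 𝓡 P).toIdeal from h ▸ trivial))
  mem_or_mem' {x y} h := by
    rw [mem_bodyComap, map_mul] at h
    exact hP.mem_or_mem h

/-- Every super-ideal containing the odd elements comes from the body. -/
theorem exists_eq_bodyComap {𝔫 : HomogeneousIdeal 𝓡} (h : ∀ x ∈ 𝓡 1, x ∈ 𝔫.toIdeal) :
    ∃ P : Ideal (Body 𝓡), 𝔫 = bodyComap 𝓡 P := by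
  have hle : oddIdeal 𝓡 ≤ 𝔫.toIdeal := Ideal.span_le.2 h
  refine ⟨𝔫.toIdeal.map (Ideal.Quotient.mk (oddIdeal 𝓡)), ?_⟩
  refine HomogeneousIdeal.ext (Ideal.ext fun x => ?_)
  rw [mem_bodyComap, Ideal.mem_map_iff_of_surjective _ Ideal.Quotient.mk_surjective]
  refine ⟨fun hx => ⟨x, hx, rfl⟩, fun ⟨y, hy, hyx⟩ => ?_⟩
  have h1 := hle (Ideal.Quotient.eq.1 hyx.symm)
  simpa using add_mem h1 hy

theorem odd_mem_of_isPrime {𝔭 : HomogeneousIdeal 𝓡} [h : 𝔭.toIdeal.IsPrime] {x : R}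
    (hx : x ∈ 𝓡 1) : x ∈ 𝔭.toIdeal := by
  have h0 : x * x ∈ 𝔭.toIdeal := by
    rw [SuperCommutative.odd_mul_self (𝒜 := 𝓡) x hx]
    exact zero_mem _
  exact (h.mem_or_mem h0).elim id id

/-- Otherwise `1 = n + r x` with `n ∈ 𝔫`. Its even part reads `1 = n₀ + p x` with `p` odd. As `(p
x)² = 0`, the element `n₀ = 1 - p x` of `𝔫` has the inverse `1 + p x`. -/
theorem odd_mem_of_isMaximal {𝔫 : HomogeneousIdeal 𝓡} (h : 𝔫.toIdeal.IsMaximal) {x : R}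
    (hx : x ∈ 𝓡 1) : x ∈ 𝔫.toIdeal := by
  by_contra hxn
  have h1 : 𝔫.toIdeal ⊔ Ideal.span {x} = ⊤ := by
    refine h.1.2 _ (lt_of_le_of_ne le_sup_left fun h => hxn ?_)
    rw [h]
    exact Ideal.mem_sup_right (Ideal.mem_span_singleton_self x)
  obtain ⟨n, hn, w, hw, hnw⟩ := Submodule.mem_sup.1 ((Ideal.eq_top_iff_one _).1 h1)
  obtain ⟨r, rfl⟩ := Ideal.mem_span_singleton'.1 hw
  have h2 : (DirectSum.decompose 𝓡 n 0 : R) + (DirectSum.decompose 𝓡 r 1 : R) * x = 1 := by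
    have h3 := congrArg (fun z => (DirectSum.decompose 𝓡 z 0 : R)) hnw
    simp only [DirectSum.decompose_add, DirectSum.add_apply, AddSubgroup.coe_add] at h3
    rw [decompose_zero_mul, DirectSum.decompose_of_mem_same 𝓡 hx,
      DirectSum.decompose_of_mem_ne 𝓡 hx (show (1 : ZMod 2) ≠ 0 by decide), mul_zero, zero_add,
      DirectSum.decompose_of_mem_same 𝓡 (SetLike.GradedOne.one_mem (A := 𝓡))] at h3
    exact h3
  set p : R := (DirectSum.decompose 𝓡 r 1 : R) with hp
  have hp1 : p ∈ 𝓡 1 := SetLike.coe_mem _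
  have h3 : p * x * (p * x) = 0 := by
    rw [mul_assoc, ← mul_assoc x, odd_anticomm 𝓡 hx hp1, neg_mul, mul_assoc p x x,
      SuperCommutative.odd_mul_self (𝒜 := 𝓡) x hx]
    simp
  have h4 : (1 + p * x) * (DirectSum.decompose 𝓡 n 0 : R) = 1 := by
    rw [eq_sub_of_add_eq h2, mul_sub, add_mul _ _ (p * x), h3]
    simp
  refine h.ne_top ((Ideal.eq_top_iff_one _).2 ?_)
  rw [← h4]
  exact Ideal.mul_mem_left _ _ (𝔫.is_homogeneous' 0 hn)

/-- Maximal super-ideals contain the odd elements and so come from the body; this pins down the `𝔪`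
quantified in `IsRegularLocal`. -/
theorem isLocalWith_iff [IsLocalRing (Body 𝓡)] {𝔪 : HomogeneousIdeal 𝓡} :
    IsLocalWith 𝓡 𝔪 ↔ 𝔪 = bodyComap 𝓡 (IsLocalRing.maximalIdeal (Body 𝓡)) := by
  have hmax : (bodyComap 𝓡 (IsLocalRing.maximalIdeal (Body 𝓡))).toIdeal.IsMaximal :=
    Ideal.comap_isMaximal_of_surjective (Ideal.Quotient.mk (oddIdeal 𝓡))
      Ideal.Quotient.mk_surjective
  refine ⟨fun h => ((h _).1 hmax).symm, ?_⟩
  rintro rfl 𝔫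
  refine ⟨fun h => ?_, fun h => h ▸ hmax⟩
  obtain ⟨P, rfl⟩ := exists_eq_bodyComap 𝓡 fun x hx => odd_mem_of_isMaximal 𝓡 h hx
  refine HomogeneousIdeal.ext (h.eq_of_le hmax.ne_top ?_)
  refine Ideal.comap_mono (IsLocalRing.le_maximalIdeal fun hP => h.ne_top ?_)
  rw [hP]
  exact Ideal.comap_top

/-- The local condition on the odd part: it is generated by `z₁, …, zₛ` such that the annihilator
of the product `z₁ ⋯ zₛ` vanishes in the body. -/
def HasFreeOddGenerators : Prop :=
  ∃ (s : ℕ) (z : Fin s → R), (∀ i, z i ∈ 𝓡 1) ∧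
    (∀ x ∈ 𝓡 1, x ∈ Submodule.span (𝓡 0) (Set.range z)) ∧
    ∀ c : 𝓡 0, (c : R) * (List.ofFn z).prod = 0 → (c : R) ∈ oddIdeal 𝓡

section Cotangent

variable [IsLocalRing (𝓡 0)] [IsLocalRing (Body 𝓡)]

theorem evenPart_bodyComap_maximalIdeal :
    evenPart 𝓡 (bodyComap 𝓡 (IsLocalRing.maximalIdeal (Body 𝓡))) =
      IsLocalRing.maximalIdeal (𝓡 0) := by
  have : IsLocalHom (evenToBody 𝓡) := .of_surjective _ (evenToBody_surjective 𝓡)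
  ext x
  rw [evenPart_bodyComap, Ideal.mem_comap, IsLocalRing.mem_maximalIdeal,
    IsLocalRing.mem_maximalIdeal, mem_nonunits_iff, mem_nonunits_iff, isUnit_map_iff]

local notation "𝔐" => bodyComap 𝓡 (IsLocalRing.maximalIdeal (Body 𝓡))

theorem mk_mem_maximalIdeal_sq {x : R} (hx : x ∈ (𝔐).toIdeal ^ 2) :
    Ideal.Quotient.mk (oddIdeal 𝓡) x ∈ IsLocalRing.maximalIdeal (Body 𝓡) ^ 2 := by
  rw [Submodule.pow_succ, Submodule.pow_one] at hx
  induction hx using Submodule.smul_induction_on' with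
  | smul a ha b hb =>
    rw [smul_eq_mul, map_mul, pow_two]
    exact Ideal.mul_mem_mul ha hb
  | add a _ b _ ha hb => rw [map_add]; exact add_mem ha hb

/-- Lift the class of `x` to some `y` in the square of the maximal ideal of `R₀`. Then `x - y` is an
even element of `I_R`, so it lies in `I_R²`, which is contained in `𝔐²`. -/
theorem mem_sq_of_mk_mem {x : R} (hx : x ∈ 𝓡 0)
    (h : Ideal.Quotient.mk (oddIdeal 𝓡) x ∈ IsLocalRing.maximalIdeal (Body 𝓡) ^ 2) :
    x ∈ (𝔐).toIdeal ^ 2 := by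
  have : IsLocalHom (evenToBody 𝓡) := .of_surjective _ (evenToBody_surjective 𝓡)
  have h1 : evenToBody 𝓡 ⟨x, hx⟩ ∈
      (IsLocalRing.maximalIdeal (𝓡 0) ^ 2).map (evenToBody 𝓡) := by
    rw [Ideal.map_pow, IsLocalRing.map_maximalIdeal_of_surjective _ (evenToBody_surjective 𝓡)]
    exact h
  obtain ⟨y, hy, hyx⟩ := (Ideal.mem_map_iff_of_surjective _ (evenToBody_surjective 𝓡)).1 h1
  have h2 : (y : R) ∈ (𝔐).toIdeal ^ 2 := by
    clear hyx
    rw [pow_two] at hy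
    rw [Submodule.pow_succ, Submodule.pow_one]
    induction hy using Submodule.smul_induction_on' with
    | smul a ha b hb =>
      rw [← evenPart_bodyComap_maximalIdeal] at ha hb
      exact Ideal.mul_mem_mul (I := (𝔐).toIdeal) (J := (𝔐).toIdeal) ha hb
    | add a _ b _ ha hb => exact add_mem ha hb
  have h3 : x - y ∈ oddIdeal 𝓡 := by
    have h4 : evenToBody 𝓡 (⟨x, hx⟩ - y) = 0 := by rw [map_sub, hyx, sub_self]
    exact (evenToBody_eq_zero_iff 𝓡).1 h4
  have h5 := decompose_zero_mem_sq 𝓡 h3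
  rw [DirectSum.decompose_of_mem_same 𝓡 (sub_mem hx y.2)] at h5
  have h6 := add_mem (Ideal.pow_right_mono (oddIdeal_le_bodyComap 𝓡 _) 2 h5) h2
  rwa [sub_add_cancel] at h6

theorem cotangentDim_zero_eq [IsNoetherianRing (Body 𝓡)] : cotangentDim 𝓡 𝔐 0 =
    ((IsLocalRing.maximalIdeal (Body 𝓡)).spanFinrank : ℕ∞) := by
  rw [IsLocalRing.spanFinrank_maximalIdeal_eq_finrank_cotangentSpace]
  let i : Residue 𝓡 𝔐 →+* IsLocalRing.ResidueField (Body 𝓡) :=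
    Ideal.quotientMap (I := evenPart 𝓡 𝔐) (IsLocalRing.maximalIdeal (Body 𝓡)) (evenToBody 𝓡) le_rfl
  have hi : Function.Bijective i :=
    ⟨Ideal.quotientMap_injective' le_rfl,
      Ideal.quotientMap_surjective (evenToBody_surjective 𝓡)⟩
  let φ : idealComponent 𝓡 𝔐 0 →+ IsLocalRing.CotangentSpace (Body 𝓡) :=
    { toFun := fun x => (IsLocalRing.maximalIdeal (Body 𝓡)).toCotangent
        ⟨Ideal.Quotient.mk (oddIdeal 𝓡) (x : R), x.2.1⟩
      map_zero' := by
        rw [Ideal.toCotangent_eq_zero]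
        change Ideal.Quotient.mk (oddIdeal 𝓡) 0 ∈ _
        rw [map_zero]
        exact zero_mem _
      map_add' := fun x y => by
        rw [← map_add]
        rfl }
  have hφ : Function.Surjective φ := by
    intro c
    obtain ⟨⟨b, hb⟩, rfl⟩ := (IsLocalRing.maximalIdeal (Body 𝓡)).toCotangent_surjective c
    obtain ⟨e, rfl⟩ := body_exists_even 𝓡 b
    exact ⟨⟨(e : R), hb, e.2⟩, rfl⟩
  let N := Submodule.submoduleOf (((𝔐).toIdeal ^ 2).restrictScalars (𝓡 0)) (idealComponent 𝓡 𝔐 0)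
  have hker : ∀ x, φ x = 0 ↔ x ∈ N := by
    intro x
    refine (Ideal.toCotangent_eq_zero _ _).trans ⟨fun h => ?_, fun h => ?_⟩
    · exact mem_sq_of_mk_mem 𝓡 x.2.2 h
    · exact mk_mem_maximalIdeal_sq 𝓡 h
  let ψ : Cotangent 𝓡 𝔐 0 →+ IsLocalRing.CotangentSpace (Body 𝓡) :=
    QuotientAddGroup.lift N.toAddSubgroup φ fun x hx => (hker x).2 hx
  have hψ : Function.Bijective ψ := by
    constructor
    · rw [injective_iff_map_eq_zero]
      intro c hc
      obtain ⟨x, rfl⟩ := Submodule.Quotient.mk_surjective _ c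
      exact (Submodule.Quotient.mk_eq_zero _).2 ((hker x).1 hc)
    · intro c
      obtain ⟨x, rfl⟩ := hφ c
      exact ⟨Submodule.Quotient.mk x, rfl⟩
  -- The two spaces live over different but isomorphic fields, so the rank is carried along a
  -- semilinear bijection.
  have hrank := rank_eq_of_equiv_equiv i (AddEquiv.ofBijective ψ hψ) hi (by
    intro r c
    obtain ⟨r, rfl⟩ := Ideal.Quotient.mk_surjective r
    obtain ⟨x, rfl⟩ := Submodule.Quotient.mk_surjective _ c
    change (IsLocalRing.maximalIdeal (Body 𝓡)).toCotangent _ =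
      evenToBody 𝓡 r • (IsLocalRing.maximalIdeal (Body 𝓡)).toCotangent _
    rw [← map_smul]
    congr 1)
  rw [cotangentDim, hrank, ← Module.finrank_eq_rank, Cardinal.toENat_nat]

/-- The odd part of `a b` is `a₁ b₀ + a₀ b₁`, and the even parts lie in the maximal ideal of `R₀`.
-/
theorem mem_maximalIdeal_smul_of_mem_sq {x : R} (hx : x ∈ (𝔐).toIdeal ^ 2) :
    (DirectSum.decompose 𝓡 x 1 : R) ∈
      IsLocalRing.maximalIdeal (𝓡 0) • component 𝓡 1 := by
  rw [Submodule.pow_succ, Submodule.pow_one] at hx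
  have h0 : ∀ a ∈ (𝔐).toIdeal, DirectSum.decompose 𝓡 a 0 ∈ IsLocalRing.maximalIdeal (𝓡 0) := by
    intro a ha
    rw [← evenPart_bodyComap_maximalIdeal]
    exact (𝔐).is_homogeneous' 0 ha
  induction hx using Submodule.smul_induction_on' with
  | smul a ha b hb =>
    rw [smul_eq_mul, decompose_one_mul, ← even_comm 𝓡 (SetLike.coe_mem _)]
    exact add_mem (Submodule.smul_mem_smul (h0 b hb) (SetLike.coe_mem _))
      (Submodule.smul_mem_smul (h0 a ha) (SetLike.coe_mem _))
  | add a _ b _ ha hb =>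
    rw [DirectSum.decompose_add, DirectSum.add_apply, AddSubgroup.coe_add]
    exact add_mem ha hb

theorem maximalIdeal_smul_le_sq :
    IsLocalRing.maximalIdeal (𝓡 0) • component 𝓡 1 ≤
      ((𝔐).toIdeal ^ 2).restrictScalars (𝓡 0) := by
  rw [Submodule.smul_le]
  intro r hr x hx
  rw [← evenPart_bodyComap_maximalIdeal] at hr
  rw [Submodule.pow_succ, Submodule.pow_one]
  exact Ideal.mul_mem_mul (I := (𝔐).toIdeal) (J := (𝔐).toIdeal) hr
    (oddIdeal_le_bodyComap 𝓡 _ (odd_mem_oddIdeal 𝓡 hx))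

/-- With `𝔪₀` the maximal ideal of `R₀`, the odd part of `𝔐/𝔐²` is `R₁/𝔪₀R₁`, whose dimension counts
minimal generators by Nakayama. -/
theorem cotangentDim_one_eq [Module.Finite (𝓡 0) (component 𝓡 1)] : cotangentDim 𝓡 𝔐 1 =
    ((component 𝓡 1).spanFinrank : ℕ∞) := by
  rw [IsLocalRing.spanFinrank_eq_finrank_quotient _ (Module.Finite.iff_fg.1 ‹_›)]
  have hc : idealComponent 𝓡 𝔐 1 = component 𝓡 1 := by
    refine inf_eq_right.2 fun x hx => ?_
    exact (oddIdeal_le_bodyComap 𝓡 (IsLocalRing.maximalIdeal (Body 𝓡)) :)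
      (odd_mem_oddIdeal 𝓡 hx)
  let i : Residue 𝓡 𝔐 ≃+* 𝓡 0 ⧸ IsLocalRing.maximalIdeal (𝓡 0) :=
    Ideal.quotEquivOfEq (evenPart_bodyComap_maximalIdeal 𝓡)
  let j : Cotangent 𝓡 𝔐 1 ≃ₗ[𝓡 0] component 𝓡 1 ⧸
      (IsLocalRing.maximalIdeal (𝓡 0) • ⊤ : Submodule (𝓡 0) (component 𝓡 1)) :=
    Submodule.Quotient.equiv _ _ (LinearEquiv.ofEq _ _ hc) (by
      have h1 : ∀ x : component 𝓡 1, x ∈ (IsLocalRing.maximalIdeal (𝓡 0) • ⊤ :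
          Submodule (𝓡 0) (component 𝓡 1)) ↔ (x : R) ∈ (𝔐).toIdeal ^ 2 := by
        intro x
        have h2 : (IsLocalRing.maximalIdeal (𝓡 0) • ⊤ :
            Submodule (𝓡 0) (component 𝓡 1)).map (component 𝓡 1).subtype =
              IsLocalRing.maximalIdeal (𝓡 0) • component 𝓡 1 := by
          rw [Submodule.map_smul'', Submodule.map_subtype_top]
        refine ⟨fun hx => maximalIdeal_smul_le_sq 𝓡 (h2 ▸ Submodule.mem_map_of_mem hx),
          fun hx => ?_⟩
        have h3 := mem_maximalIdeal_smul_of_mem_sq 𝓡 hx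
        rw [DirectSum.decompose_of_mem_same 𝓡 x.2, ← h2] at h3
        obtain ⟨y, hy, hyx⟩ := h3
        rwa [Subtype.ext hyx] at hy
      ext x
      rw [h1]
      constructor
      · rintro ⟨y, hy, rfl⟩
        exact hy
      · intro hx
        exact ⟨⟨(x : R), hc.symm ▸ x.2⟩, hx, rfl⟩)
  have hrank := rank_eq_of_equiv_equiv i j.toAddEquiv i.bijective (by
    intro r c
    obtain ⟨r, rfl⟩ := Ideal.Quotient.mk_surjective r
    exact j.map_smul r c)
  have : Module.Finite (𝓡 0 ⧸ IsLocalRing.maximalIdeal (𝓡 0)) (component 𝓡 1 ⧸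
      (IsLocalRing.maximalIdeal (𝓡 0) • ⊤ : Submodule (𝓡 0) (component 𝓡 1))) :=
    Module.Finite.of_restrictScalars_finite (𝓡 0) _ _
  let := Ideal.Quotient.field (IsLocalRing.maximalIdeal (𝓡 0))
  rw [cotangentDim, hrank, ← Module.finrank_eq_rank, Cardinal.toENat_nat]

end Cotangent

/-- More than `s` odd elements have product zero. The annihilator is then all of `R₀`, and the zero
ring has dimension `⊥`, unlike `R₀`. -/
theorem oddKrullDim_le_of_generators [Nontrivial (𝓡 0)] {s : ℕ} {z : Fin s → R}
    (hz : ∀ i, z i ∈ 𝓡 1)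
    (hspan : ∀ x ∈ 𝓡 1, x ∈ Submodule.span (𝓡 0) (Set.range z)) : oddKrullDim 𝓡 ≤ s := by
  refine iSup₂_le fun n ⟨y, hy, hdim⟩ => ?_
  by_contra! hn
  have h0 := prod_eq_zero_of_mem_span 𝓡 (Nat.cast_lt.1 hn) hz fun i => hspan _ (hy i)
  have h1 : evenAnn 𝓡 (List.ofFn y).prod = ⊤ := by
    rw [Ideal.eq_top_iff_one, h0]
    exact mul_zero _
  have : Subsingleton (𝓡 0 ⧸ evenAnn 𝓡 (List.ofFn y).prod) :=
    Ideal.Quotient.subsingleton_iff.2 h1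
  rw [ringKrullDim_eq_bot_of_subsingleton (R := 𝓡 0 ⧸ _)] at hdim
  have h2 := ringKrullDim_nonneg_of_nontrivial (R := 𝓡 0)
  rw [hdim] at h2
  simp at h2

theorem isOddParameterSystem_zero : IsOddParameterSystem 𝓡 (Fin.elim0 : Fin 0 → R) := by
  refine ⟨fun i => i.elim0, ?_⟩
  have h : evenAnn 𝓡 (List.ofFn (Fin.elim0 : Fin 0 → R)).prod = ⊥ := by
    refine (Submodule.eq_bot_iff _).2 fun x hx => Subtype.ext ?_
    have h1 : (x : R) * (List.ofFn (Fin.elim0 : Fin 0 → R)).prod = 0 := hx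
    simpa using h1
  rw [h]
  exact (ringKrullDim_eq_of_ringEquiv (RingEquiv.quotientBot (𝓡 0))).symm

/-- A finite supremum of naturals is attained, since otherwise `s - 1` would be a bound. The case `s
= 0`, where `s - 1` truncates, is served by the empty system. -/
theorem exists_isOddParameterSystem {s : ℕ} (h : oddKrullDim 𝓡 = s) :
    ∃ y : Fin s → R, IsOddParameterSystem 𝓡 y := by
  rcases Nat.eq_zero_or_pos s with rfl | hs
  · exact ⟨_, isOddParameterSystem_zero 𝓡⟩
  by_contra hcon
  have h1 : oddKrullDim 𝓡 ≤ (s - 1 : ℕ) := by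
    refine iSup₂_le fun n hn => Nat.cast_le.2 ?_
    have h2 : (n : ℕ∞) ≤ s := h ▸ le_iSup₂_of_le (f := fun (s : ℕ)
      (_ : ∃ y : Fin s → R, IsOddParameterSystem 𝓡 y) => (s : ℕ∞)) n hn le_rfl
    have h3 : n ≤ s := Nat.cast_le.1 h2
    have h4 : n ≠ s := fun h => hcon (h ▸ hn)
    omega
  rw [h, Nat.cast_le] at h1
  omega

theorem ringKrullDim_evenAnn_of_le_oddIdeal [Module.Finite (𝓡 0) (component 𝓡 1)] {x : R}
    (h : ∀ c : 𝓡 0, (c : R) * x = 0 → (c : R) ∈ oddIdeal 𝓡) :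
    ringKrullDim (𝓡 0) = ringKrullDim (𝓡 0 ⧸ evenAnn 𝓡 x) := by
  rw [← ringKrullDim_quotient_eq_of_le_nilradical_sup (bot_le (a := evenAnn 𝓡 x))]
  · exact (ringKrullDim_eq_of_ringEquiv (RingEquiv.quotientBot (𝓡 0))).symm
  · rw [bot_sup_eq]
    intro c hc
    exact ker_evenToBody_le_nilradical 𝓡 ((evenToBody_eq_zero_iff 𝓡).2 (h c hc))

/-- Up to nilpotents, `R₀/Ann(x)` is a quotient of the body. If `c` were nonzero in this domain, the
quotient would have strictly smaller dimension; the contradiction needs the dimension to be finite.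
-/
theorem le_oddIdeal_of_ringKrullDim_evenAnn [Module.Finite (𝓡 0) (component 𝓡 1)]
    [IsDomain (Body 𝓡)] {n : ℕ} (hn : ringKrullDim (Body 𝓡) = n) {x : R}
    (h : ringKrullDim (𝓡 0) = ringKrullDim (𝓡 0 ⧸ evenAnn 𝓡 x)) {c : 𝓡 0}
    (hc : (c : R) * x = 0) : (c : R) ∈ oddIdeal 𝓡 := by
  by_contra hcn
  have hc0 : evenToBody 𝓡 c ≠ 0 := fun h0 => hcn ((evenToBody_eq_zero_iff 𝓡).1 h0)
  rw [ringKrullDim_quotient_eq_of_le_nilradical_sup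
    (le_sup_left (a := evenAnn 𝓡 x) (b := RingHom.ker (evenToBody 𝓡)))
    (sup_le_sup_left (ker_evenToBody_le_nilradical 𝓡) _), ringKrullDim_even_eq_body] at h
  let f : Body 𝓡 →+* 𝓡 0 ⧸ evenAnn 𝓡 x ⊔ RingHom.ker (evenToBody 𝓡) :=
    RingHom.liftOfSurjective (evenToBody 𝓡) (evenToBody_surjective 𝓡)
      ⟨Ideal.Quotient.mk _, by rw [Ideal.mk_ker]; exact le_sup_right⟩
  have hf : ∀ a, f (evenToBody 𝓡 a) = Ideal.Quotient.mk _ a :=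
    RingHom.liftOfRightInverse_comp_apply _ _ _ _
  have hfs : Function.Surjective f := fun b => by
    obtain ⟨a, rfl⟩ := Ideal.Quotient.mk_surjective b
    exact ⟨_, hf a⟩
  have h1 := ringKrullDim_succ_le_of_surjective f hfs (mem_nonZeroDivisors_of_ne_zero hc0) (by
    rw [hf]
    exact Ideal.Quotient.eq_zero_iff_mem.2 (Ideal.mem_sup_left hc))
  rw [← h, hn] at h1
  have h2 : n + 1 ≤ n := by exact_mod_cast h1
  omega

theorem exists_generators_spanFinrank [Module.Finite (𝓡 0) (component 𝓡 1)] :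
    ∃ z : Fin (component 𝓡 1).spanFinrank → R, (∀ i, z i ∈ 𝓡 1) ∧
      ∀ x ∈ 𝓡 1, x ∈ Submodule.span (𝓡 0) (Set.range z) := by
  obtain ⟨t, ht, hspan⟩ := Submodule.FG.exists_span_finset_card_eq_spanFinrank
    (Module.Finite.iff_fg.1 ‹Module.Finite (𝓡 0) (component 𝓡 1)›)
  let e := t.equivFinOfCardEq ht
  have hr : Set.range (fun i => (e.symm i : R)) = t := by
    ext x
    exact ⟨fun ⟨i, hi⟩ => hi ▸ (e.symm i).2, fun hx => ⟨e ⟨x, hx⟩, by simp⟩⟩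
  refine ⟨fun i => e.symm i, fun i => ?_, fun x hx => ?_⟩
  · exact hspan.le (Submodule.subset_span (e.symm i).2)
  · rw [hr, hspan]
    exact hx

theorem spanFinrank_le_of_generators {s : ℕ} {z : Fin s → R} (hz : ∀ i, z i ∈ 𝓡 1)
    (hspan : ∀ x ∈ 𝓡 1, x ∈ Submodule.span (𝓡 0) (Set.range z)) :
    (component 𝓡 1).spanFinrank ≤ s := by
  have h : component 𝓡 1 = Submodule.span (𝓡 0) (Set.range z) := by
    refine le_antisymm hspan (Submodule.span_le.2 ?_)
    rintro _ ⟨i, rfl⟩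
    exact hz i
  rw [h, ← Set.image_univ]
  exact (Submodule.spanFinrank_span_le_ncard_of_finite (Set.toFinite _)).trans
    ((Set.ncard_image_le Set.finite_univ).trans (by simp))

/-- A Noetherian local super-ring is regular if and only if its body is a regular local ring and
its odd part is freely generated in the sense of `HasFreeOddGenerators`. -/
theorem isRegularLocal_iff [IsLocalRing (𝓡 0)] [IsNoetherianRing (𝓡 0)]
    [Module.Finite (𝓡 0) (component 𝓡 1)] :
    IsRegularLocal 𝓡 ↔ IsRegularLocalRing (Body 𝓡) ∧ HasFreeOddGenerators 𝓡 := by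
  have : Nontrivial (Body 𝓡) := by
    by_contra hcon
    rw [not_nontrivial_iff_subsingleton] at hcon
    have h := ringKrullDim_nonneg_of_nontrivial (R := 𝓡 0)
    rw [ringKrullDim_even_eq_body, ringKrullDim_eq_bot_of_subsingleton (R := Body 𝓡)] at h
    simp at h
  have : IsLocalRing (Body 𝓡) := .of_surjective' _ (evenToBody_surjective 𝓡)
  have : IsNoetherianRing (Body 𝓡) := isNoetherianRing_body 𝓡
  have h1 : IsRegularLocal 𝓡 ↔
      ringKrullDim (Body 𝓡) = (IsLocalRing.maximalIdeal (Body 𝓡)).spanFinrank ∧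
      oddKrullDim 𝓡 = (component 𝓡 1).spanFinrank := by
    simp only [IsRegularLocal, isLocalWith_iff, exists_eq_left, cotangentDim_zero_eq,
      cotangentDim_one_eq, evenKrullDim, ringKrullDim_even_eq_body]
    rfl
  rw [h1, isRegularLocalRing_iff, eq_comm, and_congr_right_iff]
  intro hreg
  obtain ⟨z, hz, hspan⟩ := exists_generators_spanFinrank 𝓡
  constructor
  · intro h
    have : IsRegularLocalRing (Body 𝓡) := (isRegularLocalRing_iff _).2 hreg
    have := IsRegularLocalRing.isDomain (Body 𝓡)
    obtain ⟨y, hy, hdim⟩ := exists_isOddParameterSystem 𝓡 h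
    refine ⟨_, z, hz, hspan, fun c hc => ?_⟩
    -- The product of the parameters `y` is a multiple of the product of the generators `z`, so
    -- whatever kills the latter kills the former.
    obtain ⟨b, hb⟩ := prod_eq_smul_of_mem_span 𝓡 hz fun i => hspan _ (hy i)
    refine le_oddIdeal_of_ringKrullDim_evenAnn 𝓡 hreg.symm hdim ?_
    rw [hb, ← mul_assoc, even_comm 𝓡 c.2, mul_assoc, hc, mul_zero]
  · rintro ⟨s, y, hy, hyspan, hann⟩
    have h2 : (s : ℕ∞) ≤ oddKrullDim 𝓡 := le_iSup₂_of_le (f := fun (s : ℕ)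
      (_ : ∃ y : Fin s → R, IsOddParameterSystem 𝓡 y) => (s : ℕ∞)) s
      ⟨y, hy, ringKrullDim_evenAnn_of_le_oddIdeal 𝓡 hann⟩ le_rfl
    -- The given generators need not be minimal; the chain `spanFinrank ≤ s ≤ oddKrullDim ≤
    -- spanFinrank` forces equality.
    have h3 := spanFinrank_le_of_generators 𝓡 hy hyspan
    refine le_antisymm (oddKrullDim_le_of_generators 𝓡 hz hspan) (le_trans ?_ h2)
    exact_mod_cast h3

end Local

/-! ### Clearing denominators: the odd generator condition on `S⁻¹A` read in `A`. -/

section LocalizationTransfer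

set_option linter.unusedSectionVars false

variable {A : Type u} [Ring A] (𝒜 : ZMod 2 → AddSubgroup A) [GradedRing 𝒜] [SuperCommutative 𝒜]

variable (S : Submonoid (𝒜 0))

theorem mk_mem_locGrading {i : ZMod 2} {a : A} (ha : a ∈ 𝒜 i) (s : S) :
    LocalizedModule.mk a s ∈ locGrading 𝒜 S i := ⟨a, ha, s, rfl⟩

/-- The ring homomorphism `A → S⁻¹A`. -/
noncomputable def locHom : A →+* LocalizedModule S A where
  toFun a := LocalizedModule.mk a 1
  map_one' := OreLocalization.one_def.symm
  map_mul' a b := by rw [LocalizedModule.mk_mul_mk, one_mul]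
  map_zero' := LocalizedModule.zero_mk 1
  map_add' a b := by rw [LocalizedModule.mk_add_mk, one_smul, one_smul, one_mul]

theorem locHom_apply (a : A) : locHom 𝒜 S a = LocalizedModule.mk a 1 := rfl

noncomputable instance locEvenAlgebra : Algebra (𝒜 0) (locGrading 𝒜 S 0) :=
  RingHom.toAlgebra
    { toFun := fun a => ⟨LocalizedModule.mk (a : A) 1, mk_mem_locGrading 𝒜 S a.2 1⟩
      map_one' := Subtype.ext (locHom 𝒜 S).map_one
      map_mul' := fun a b => Subtype.ext ((locHom 𝒜 S).map_mul a b)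
      map_zero' := Subtype.ext (locHom 𝒜 S).map_zero
      map_add' := fun a b => Subtype.ext ((locHom 𝒜 S).map_add a b) }

theorem coe_algebraMap_locGrading (a : 𝒜 0) :
    (algebraMap (𝒜 0) (locGrading 𝒜 S 0) a : LocalizedModule S A) = LocalizedModule.mk (a : A) 1 :=
  rfl

theorem mk_eq_mk_iff {a b : A} {s t : S} :
    LocalizedModule.mk a s = LocalizedModule.mk b t ↔
      ∃ u : S, ((u : 𝒜 0) : A) * (((t : 𝒜 0) : A) * a) = (u : 𝒜 0) * (((s : 𝒜 0) : A) * b) :=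
  LocalizedModule.mk_eq

theorem mk_eq_zero_iff {a : A} {s : S} :
    (LocalizedModule.mk a s : LocalizedModule S A) = 0 ↔ ∃ u : S, ((u : 𝒜 0) : A) * a = 0 := by
  rw [← LocalizedModule.zero_mk 1, mk_eq_mk_iff]
  simp

theorem mk_mul_cancel (a : A) (s u : S) :
    (LocalizedModule.mk (((u : 𝒜 0) : A) * a) (u * s) : LocalizedModule S A) =
      LocalizedModule.mk a s :=
  LocalizedModule.mk_cancel_common_left u s a

instance locEven_isLocalization : IsLocalization S (locGrading 𝒜 S 0) where
  map_units := by
    intro s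
    refine IsUnit.of_mul_eq_one ⟨LocalizedModule.mk 1 s,
      mk_mem_locGrading 𝒜 S SetLike.GradedOne.one_mem s⟩ (Subtype.ext ?_)
    change LocalizedModule.mk ((s : 𝒜 0) : A) 1 * LocalizedModule.mk 1 s = 1
    rw [LocalizedModule.mk_mul_mk, mul_comm 1 s]
    exact (mk_mul_cancel 𝒜 S 1 1 s).trans OreLocalization.one_def.symm
  surj := by
    rintro ⟨_, a, ha, s, rfl⟩
    refine ⟨(⟨a, ha⟩, s), Subtype.ext ?_⟩
    change LocalizedModule.mk a s * LocalizedModule.mk ((s : 𝒜 0) : A) 1 = LocalizedModule.mk a 1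
    rw [LocalizedModule.mk_mul_mk, ← even_comm 𝒜 (s : 𝒜 0).2]
    exact mk_mul_cancel 𝒜 S a 1 s
  exists_of_eq := by
    intro x y h
    obtain ⟨u, hu⟩ := (mk_eq_mk_iff 𝒜 S).1 (congrArg Subtype.val h)
    refine ⟨u, Subtype.ext ?_⟩
    simpa using hu

theorem locEven_smul_def (r : locGrading 𝒜 S 0) (x : LocalizedModule S A) :
    r • x = (r : LocalizedModule S A) * x := rfl

theorem mk_mem_span_of_mul_mem_span {n : ℕ} {a : Fin n → A} {t s : S} {x : A}
    (h : ((t : 𝒜 0) : A) * x ∈ Submodule.span (𝒜 0) (Set.range a)) :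
    LocalizedModule.mk x s ∈ Submodule.span (locGrading 𝒜 S 0)
      (Set.range fun i => (LocalizedModule.mk (a i) 1 : LocalizedModule S A)) := by
  have h1 : ∀ y ∈ Submodule.span (𝒜 0) (Set.range a), LocalizedModule.mk y 1 ∈
      Submodule.span (locGrading 𝒜 S 0)
        (Set.range fun i => (LocalizedModule.mk (a i) 1 : LocalizedModule S A)) := by
    intro y hy
    induction hy using Submodule.span_induction with
    | mem y hy =>
      obtain ⟨i, rfl⟩ := hy
      exact Submodule.subset_span ⟨i, rfl⟩
    | zero => rw [LocalizedModule.zero_mk]; exact zero_mem _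
    | add y z _ _ hy hz =>
      have := (locHom 𝒜 S).map_add y z
      rw [locHom_apply] at this
      rw [this]
      exact add_mem hy hz
    | smul r y _ hy =>
      have := (locHom 𝒜 S).map_mul r y
      rw [locHom_apply] at this
      rw [even_smul_def, this]
      exact Submodule.smul_mem _ (algebraMap (𝒜 0) (locGrading 𝒜 S 0) r) hy
  have h2 := Submodule.smul_mem _ (⟨LocalizedModule.mk 1 (t * s),
    mk_mem_locGrading 𝒜 S SetLike.GradedOne.one_mem _⟩ : locGrading 𝒜 S 0) (h1 _ h)
  rw [locEven_smul_def, LocalizedModule.mk_mul_mk, mul_one, one_mul, mk_mul_cancel] at h2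
  exact h2

theorem locGrading_finite [Module.Finite (𝒜 0) (component 𝒜 1)] :
    Module.Finite (locGrading 𝒜 S 0) (component (locGrading 𝒜 S) 1) := by
  obtain ⟨n, a, ha, hspan⟩ := exists_odd_generators 𝒜
  rw [Module.Finite.iff_fg]
  have h : component (locGrading 𝒜 S) 1 = Submodule.span (locGrading 𝒜 S 0)
      (Set.range fun i => (LocalizedModule.mk (a i) 1 : LocalizedModule S A)) := by
    refine le_antisymm ?_ (Submodule.span_le.2 ?_)
    · rintro _ ⟨x, hx, s, rfl⟩
      refine mk_mem_span_of_mul_mem_span 𝒜 S (t := 1) ?_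
      rw [show (((1 : S) : 𝒜 0) : A) = 1 from rfl, one_mul]
      exact hspan x hx
    · rintro _ ⟨i, rfl⟩
      exact mk_mem_locGrading 𝒜 S (ha i) 1
  rw [h]
  exact Submodule.fg_span (Set.finite_range _)

theorem mk_mem_oddIdeal {a : A} (ha : a ∈ oddIdeal 𝒜) (s : S) :
    LocalizedModule.mk a s ∈ oddIdeal (locGrading 𝒜 S) := by
  induction ha using Submodule.span_induction with
  | mem a ha => exact odd_mem_oddIdeal _ (mk_mem_locGrading 𝒜 S ha s)
  | zero => rw [LocalizedModule.zero_mk]; exact zero_mem _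
  | add a b _ _ ha hb =>
    rw [← mk_mul_cancel 𝒜 S _ s s, mul_add]
    have h := add_mem ha hb
    rwa [LocalizedModule.mk_add_mk] at h
  | smul r a _ ha =>
    rw [smul_eq_mul, ← one_mul s, ← LocalizedModule.mk_mul_mk]
    exact Ideal.mul_mem_left _ _ ha

theorem mk_mem_oddIdeal_iff {a : A} {s : S} :
    LocalizedModule.mk a s ∈ oddIdeal (locGrading 𝒜 S) ↔
      ∃ u : S, ((u : 𝒜 0) : A) * a ∈ oddIdeal 𝒜 := by
  constructor
  · intro h
    have h1 : ∀ x ∈ oddIdeal (locGrading 𝒜 S), ∃ b ∈ oddIdeal 𝒜, ∃ t : S,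
        x = LocalizedModule.mk b t := by
      intro x hx
      induction hx using Submodule.span_induction with
      | mem x hx =>
        obtain ⟨b, hb, t, rfl⟩ := hx
        exact ⟨b, odd_mem_oddIdeal 𝒜 hb, t, rfl⟩
      | zero => exact ⟨0, zero_mem _, 1, (LocalizedModule.zero_mk 1).symm⟩
      | add x y _ _ hx hy =>
        obtain ⟨b, hb, t, rfl⟩ := hx
        obtain ⟨c, hc, v, rfl⟩ := hy
        exact ⟨_, add_mem (Ideal.mul_mem_left _ _ hb) (Ideal.mul_mem_left _ _ hc), _,
          LocalizedModule.mk_add_mk⟩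
      | smul r x _ hx =>
        obtain ⟨b, hb, t, rfl⟩ := hx
        induction r with
        | _ r v =>
          exact ⟨r * b, Ideal.mul_mem_left _ _ hb, v * t, LocalizedModule.mk_mul_mk⟩
    obtain ⟨b, hb, t, hbt⟩ := h1 _ h
    obtain ⟨u, hu⟩ := (mk_eq_mk_iff 𝒜 S).1 hbt
    refine ⟨u * t, ?_⟩
    rw [show (((u * t : S) : 𝒜 0) : A) = (u : 𝒜 0) * (t : 𝒜 0) from rfl, mul_assoc, hu]
    exact Ideal.mul_mem_left _ _ (Ideal.mul_mem_left _ _ hb)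
  · rintro ⟨u, hu⟩
    rw [← mk_mul_cancel 𝒜 S a s u]
    exact mk_mem_oddIdeal 𝒜 S hu _

/-- The condition on `A` expressing that the odd part of `S⁻¹A` is freely generated. -/
def HasFreeOddGeneratorsAt : Prop :=
  ∃ (n : ℕ) (a : Fin n → A), (∀ i, a i ∈ 𝒜 1) ∧
    (∃ t : S, ∀ x ∈ 𝒜 1, ((t : 𝒜 0) : A) * x ∈ Submodule.span (𝒜 0) (Set.range a)) ∧
    ∀ c : 𝒜 0, (c : A) * (List.ofFn a).prod = 0 → ∃ u : S, ((u : 𝒜 0) : A) * c ∈ oddIdeal 𝒜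

theorem prod_mk {n : ℕ} (a : Fin n → A) (s : Fin n → S) :
    (List.ofFn fun i => (LocalizedModule.mk (a i) (s i) : LocalizedModule S A)).prod =
      LocalizedModule.mk (List.ofFn a).prod (List.ofFn s).prod := by
  induction n with
  | zero => simpa using OreLocalization.one_def
  | succ n ih => simp [List.ofFn_succ, ih, LocalizedModule.mk_mul_mk]

theorem exists_mul_mem_span_of_mk_mem_span {n : ℕ} {a : Fin n → A} {s : Fin n → S} {t : S} {x : A}
    (h : LocalizedModule.mk x t ∈ Submodule.span (locGrading 𝒜 S 0)
      (Set.range fun i => (LocalizedModule.mk (a i) (s i) : LocalizedModule S A))) :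
    ∃ u : S, ((u : 𝒜 0) : A) * x ∈ Submodule.span (𝒜 0) (Set.range a) := by
  have h1 : ∀ y ∈ Submodule.span (locGrading 𝒜 S 0)
      (Set.range fun i => (LocalizedModule.mk (a i) (s i) : LocalizedModule S A)),
      ∃ b ∈ Submodule.span (𝒜 0) (Set.range a), ∃ v : S, y = LocalizedModule.mk b v := by
    intro y hy
    induction hy using Submodule.span_induction with
    | mem y hy =>
      obtain ⟨i, rfl⟩ := hy
      exact ⟨_, Submodule.subset_span ⟨i, rfl⟩, _, rfl⟩
    | zero => exact ⟨0, zero_mem _, 1, (LocalizedModule.zero_mk 1).symm⟩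
    | add x y _ _ hx hy =>
      obtain ⟨b, hb, t, rfl⟩ := hx
      obtain ⟨c, hc, v, rfl⟩ := hy
      exact ⟨_, add_mem (Submodule.smul_mem _ (v : 𝒜 0) hb) (Submodule.smul_mem _ (t : 𝒜 0) hc), _,
        LocalizedModule.mk_add_mk⟩
    | smul r x _ hx =>
      obtain ⟨b, hb, t, rfl⟩ := hx
      obtain ⟨_, r, hr, v, rfl⟩ := r
      exact ⟨r * b, Submodule.smul_mem _ (⟨r, hr⟩ : 𝒜 0) hb, v * t, LocalizedModule.mk_mul_mk⟩
  obtain ⟨b, hb, v, hbv⟩ := h1 _ h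
  obtain ⟨u, hu⟩ := (mk_eq_mk_iff 𝒜 S).1 hbv
  refine ⟨u * v, ?_⟩
  rw [show (((u * v : S) : 𝒜 0) : A) = (u : 𝒜 0) * (v : 𝒜 0) from rfl, mul_assoc, hu]
  exact Submodule.smul_mem _ (u : 𝒜 0) (Submodule.smul_mem _ (t : 𝒜 0) hb)

theorem hasFreeOddGenerators_localization_iff [Module.Finite (𝒜 0) (component 𝒜 1)] :
    HasFreeOddGenerators (locGrading 𝒜 S) ↔ HasFreeOddGeneratorsAt 𝒜 S := by
  constructor
  · rintro ⟨n, z, hz, hspan, hann⟩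
    choose a ha s has using hz
    obtain rfl : z = fun i => LocalizedModule.mk (a i) (s i) := funext has
    refine ⟨n, a, ha, ?_, fun c hc => ?_⟩
    · obtain ⟨m, g, hg, hgspan⟩ := exists_odd_generators 𝒜
      choose u hu using fun i => exists_mul_mem_span_of_mk_mem_span 𝒜 S
        (hspan _ (mk_mem_locGrading 𝒜 S (hg i) 1))
      -- Each of the finitely many generators of `A₁` has its own denominator; their product serves
      -- all of `A₁`.
      refine ⟨∏ i, u i, fun x hx => ?_⟩
      have h := hgspan x hx
      clear hx
      induction h using Submodule.span_induction with
      | mem x hx =>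
        obtain ⟨i, rfl⟩ := hx
        rw [← Finset.prod_erase_mul _ _ (Finset.mem_univ i)]
        change (((∏ j ∈ Finset.univ.erase i, u j : S) : 𝒜 0) : A) * ((u i : 𝒜 0) : A) * g i ∈ _
        rw [mul_assoc]
        exact Submodule.smul_mem _ ((∏ j ∈ Finset.univ.erase i, u j : S) : 𝒜 0) (hu i)
      | zero => simp
      | add x y _ _ hx hy => rw [mul_add]; exact add_mem hx hy
      | smul r x _ hx =>
        rw [← even_smul_def, smul_comm]
        exact Submodule.smul_mem _ r hx
    · have h1 := hann (algebraMap (𝒜 0) (locGrading 𝒜 S 0) c) (by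
        rw [coe_algebraMap_locGrading, prod_mk, LocalizedModule.mk_mul_mk, hc,
          LocalizedModule.zero_mk])
      exact (mk_mem_oddIdeal_iff 𝒜 S).1 h1
  · rintro ⟨n, a, ha, ⟨t, ht⟩, hann⟩
    refine ⟨n, fun i => LocalizedModule.mk (a i) 1, fun i => mk_mem_locGrading 𝒜 S (ha i) 1, ?_, ?_⟩
    · rintro _ ⟨x, hx, s, rfl⟩
      exact mk_mem_span_of_mul_mem_span 𝒜 S (ht x hx)
    · rintro ⟨_, c, hc, s, rfl⟩ h
      rw [prod_mk, LocalizedModule.mk_mul_mk, mk_eq_zero_iff] at h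
      obtain ⟨u, hu⟩ := h
      rw [← mul_assoc] at hu
      let c' : 𝒜 0 := ⟨c, hc⟩
      obtain ⟨v, hv⟩ := hann ((u : 𝒜 0) * c') hu
      refine (mk_mem_oddIdeal_iff 𝒜 S).2 ⟨v * u, ?_⟩
      change ((v : 𝒜 0) : A) * ((u : 𝒜 0) : A) * c ∈ _
      rw [mul_assoc]
      exact hv

end LocalizationTransfer

/-! ### The body of a localization is a localization of the body. -/

section BodyLocalization

set_option linter.unusedSectionVars false

variable {A : Type u} [Ring A] (𝒜 : ZMod 2 → AddSubgroup A) [GradedRing 𝒜] [SuperCommutative 𝒜]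

variable (S : Submonoid (𝒜 0))

/-- The ring homomorphism from the body of `A` to the body of `S⁻¹A`. -/
noncomputable def bodyLocHom : Body 𝒜 →+* Body (locGrading 𝒜 S) :=
  Ideal.Quotient.lift (oddIdeal 𝒜)
    ((Ideal.Quotient.mk (oddIdeal (locGrading 𝒜 S))).comp (locHom 𝒜 S))
    fun _ ha => Ideal.Quotient.eq_zero_iff_mem.2 (mk_mem_oddIdeal 𝒜 S ha 1)

noncomputable instance bodyLocAlgebra : Algebra (Body 𝒜) (Body (locGrading 𝒜 S)) :=
  (bodyLocHom 𝒜 S).toAlgebra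

instance body_isLocalization :
    IsLocalization (S.map (evenToBody 𝒜)) (Body (locGrading 𝒜 S)) := by
  refine IsLocalization.of_surjective S (locGrading 𝒜 S 0) (evenToBody 𝒜)
    (evenToBody_surjective 𝒜)
    (evenToBody (locGrading 𝒜 S)) (evenToBody_surjective _) (RingHom.ext fun a => rfl) ?_
  rintro ⟨_, c, hc, s, rfl⟩ hx
  obtain ⟨u, hu⟩ := (mk_mem_oddIdeal_iff 𝒜 S).1 ((evenToBody_eq_zero_iff _).1 hx)
  let c' : 𝒜 0 := ⟨c, hc⟩
  -- The kernel upstairs is extended from the kernel below: `c/s = (1/(us)) · (uc)` with `uc ∈ I_A`.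
  have h : (⟨LocalizedModule.mk c s, mk_mem_locGrading 𝒜 S hc s⟩ : locGrading 𝒜 S 0) =
      ⟨LocalizedModule.mk 1 (u * s), mk_mem_locGrading 𝒜 S SetLike.GradedOne.one_mem _⟩ *
        algebraMap (𝒜 0) (locGrading 𝒜 S 0) (u * c') := by
    refine Subtype.ext ?_
    change LocalizedModule.mk c s = LocalizedModule.mk 1 (u * s) *
      LocalizedModule.mk (((u : 𝒜 0) : A) * c) 1
    rw [LocalizedModule.mk_mul_mk, one_mul, mul_one, mk_mul_cancel]
  rw [h]
  exact Ideal.mul_mem_left _ _ (Ideal.mem_map_of_mem _ ((evenToBody_eq_zero_iff 𝒜).2 hu))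

variable (P : Ideal (Body 𝒜)) [P.IsPrime]

theorem map_evenCompl_bodyComap :
    (evenCompl 𝒜 (bodyComap 𝒜 P)).map (evenToBody 𝒜) = P.primeCompl := by
  ext b
  constructor
  · rintro ⟨s, hs, rfl⟩
    exact hs
  · intro hb
    obtain ⟨s, rfl⟩ := evenToBody_surjective 𝒜 b
    exact ⟨s, hb, rfl⟩

theorem locEven_isLocalRing :
    IsLocalRing (locGrading 𝒜 (evenCompl 𝒜 (bodyComap 𝒜 P)) 0) := by
  have : IsLocalization.AtPrime (locGrading 𝒜 (evenCompl 𝒜 (bodyComap 𝒜 P)) 0)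
      (P.comap (evenToBody 𝒜)) :=
    locEven_isLocalization 𝒜 (evenCompl 𝒜 (bodyComap 𝒜 P))
  exact IsLocalization.AtPrime.isLocalRing _ (P.comap (evenToBody 𝒜))

theorem isRegularLocalRing_body_localization_iff :
    IsRegularLocalRing (Body (locGrading 𝒜 (evenCompl 𝒜 (bodyComap 𝒜 P)))) ↔
      IsRegularLocalRing (Localization.AtPrime P) := by
  have h := body_isLocalization 𝒜 (evenCompl 𝒜 (bodyComap 𝒜 P))
  rw [map_evenCompl_bodyComap] at h
  let e := IsLocalization.algEquiv P.primeCompl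
    (Body (locGrading 𝒜 (evenCompl 𝒜 (bodyComap 𝒜 P)))) (Localization.AtPrime P)
  exact ⟨fun _ => .of_ringEquiv e.toRingEquiv, fun _ => .of_ringEquiv e.symm.toRingEquiv⟩

variable {𝒜}

theorem isRegularLocal_localization_iff (hA : IsNoetherianSuperRing 𝒜) :
    IsRegularLocal (locGrading 𝒜 (evenCompl 𝒜 (bodyComap 𝒜 P))) ↔
      IsRegularLocalRing (Localization.AtPrime P) ∧
        HasFreeOddGeneratorsAt 𝒜 (evenCompl 𝒜 (bodyComap 𝒜 P)) := by
  have := hA.isNoetherianRing_even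
  have := hA.isNoetherian_component 1
  have := locEven_isLocalRing 𝒜 P
  have := locGrading_finite 𝒜 (evenCompl 𝒜 (bodyComap 𝒜 P))
  have : IsNoetherianRing (locGrading 𝒜 (evenCompl 𝒜 (bodyComap 𝒜 P)) 0) :=
    IsLocalization.isNoetherianRing (evenCompl 𝒜 (bodyComap 𝒜 P)) _ inferInstance
  rw [isRegularLocal_iff, isRegularLocalRing_body_localization_iff,
    hasFreeOddGenerators_localization_iff]

/-- Prime super-ideals of `A` are exactly the preimages of primes of the body, so the local
criterion can be quantified over the latter. -/
theorem isRegular_iff (hA : IsNoetherianSuperRing 𝒜) :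
    IsRegular 𝒜 ↔ IsRegularRing (Body 𝒜) ∧ ∀ (P : Ideal (Body 𝒜)) [P.IsPrime],
      HasFreeOddGeneratorsAt 𝒜 (evenCompl 𝒜 (bodyComap 𝒜 P)) := by
  have := hA.isNoetherianRing_even
  have := isNoetherianRing_body 𝒜
  have h : IsRegular 𝒜 ↔ ∀ (P : Ideal (Body 𝒜)) [P.IsPrime],
      IsRegularLocal (locGrading 𝒜 (evenCompl 𝒜 (bodyComap 𝒜 P))) := by
    refine ⟨fun h P _ => h _, fun h 𝔭 h𝔭 => ?_⟩
    obtain ⟨P, rfl⟩ := exists_eq_bodyComap 𝒜 fun x hx => odd_mem_of_isPrime 𝒜 (𝔭 := 𝔭) hx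
    have hP : P.IsPrime := by
      refine ⟨fun hP => h𝔭.ne_top ?_, fun {x y} hxy => ?_⟩
      · rw [hP]
        exact Ideal.comap_top
      · obtain ⟨x, rfl⟩ := Ideal.Quotient.mk_surjective x
        obtain ⟨y, rfl⟩ := Ideal.Quotient.mk_surjective y
        exact h𝔭.mem_or_mem hxy
    exact h P
  rw [h, isRegularRing_iff]
  simp only [isRegularLocal_localization_iff _ hA]
  exact ⟨fun h => ⟨fun P _ => (h P).1, fun P _ => (h P).2⟩, fun h P _ => ⟨h.1 P, h.2 P⟩⟩

end BodyLocalization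

/-! ### The associated graded ring and the map `λ`. -/

section GradedPieces

set_option linter.unusedSectionVars false

variable {A : Type u} [Ring A] (𝒜 : ZMod 2 → AddSubgroup A) [GradedRing 𝒜] [SuperCommutative 𝒜]

theorem odd_mem_pow_one {x : A} (hx : x ∈ 𝒜 1) : x ∈ oddIdeal 𝒜 ^ 1 := by
  rw [Submodule.pow_one]
  exact odd_mem_oddIdeal 𝒜 hx

/-- The class in `I_A / I_A²` of an odd element. -/
def oddClass (x : component 𝒜 1) : OddGr 𝒜 1 :=
  grMk (oddIdeal 𝒜) 1 ⟨x, odd_mem_pow_one 𝒜 x.2⟩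

theorem oddClass_add (x y : component 𝒜 1) :
    oddClass 𝒜 (x + y) = oddClass 𝒜 x + oddClass 𝒜 y := rfl

theorem oddClass_smul (r : 𝒜 0) (x : component 𝒜 1) :
    oddClass 𝒜 (r • x) = evenToBody 𝒜 r • oddClass 𝒜 x := rfl

theorem oddClass_surjective : Function.Surjective (oddClass 𝒜) := by
  intro m
  obtain ⟨⟨x, hx⟩, rfl⟩ := grMk_surjective (oddIdeal 𝒜) 1 m
  obtain ⟨o, ho, t, ht, rfl⟩ := exists_odd_add_sq 𝒜 ((Submodule.pow_one (oddIdeal 𝒜)).le hx)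
  refine ⟨⟨o, ho⟩, (grMk_eq_iff _).2 ?_⟩
  change o - (o + t) ∈ oddIdeal 𝒜 ^ (1 + 1)
  rw [sub_add_cancel_left]
  exact neg_mem ht

theorem oddClass_eq_zero_iff {x : component 𝒜 1} :
    oddClass 𝒜 x = 0 ↔ (x : A) ∈ oddIdeal 𝒜 ^ 2 := by
  have h := grMk_eq_iff (oddIdeal 𝒜) (n := 1) (x := ⟨x, odd_mem_pow_one 𝒜 x.2⟩) (y := 0)
  simpa using! h

/-- `oddClass` as a semilinear map. -/
def oddClassₛₗ : component 𝒜 1 →ₛₗ[evenToBody 𝒜] OddGr 𝒜 1 where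
  toFun := oddClass 𝒜
  map_add' := oddClass_add 𝒜
  map_smul' := oddClass_smul 𝒜

theorem oddGr_one_finite [Module.Finite (𝒜 0) (component 𝒜 1)] :
    Module.Finite (Body 𝒜) (OddGr 𝒜 1) := by
  have : RingHomSurjective (evenToBody 𝒜) := ⟨evenToBody_surjective 𝒜⟩
  exact Module.Finite.of_surjective (oddClassₛₗ 𝒜) (oddClass_surjective 𝒜)

theorem prod_mem_oddIdeal_pow {n : ℕ} {v : Fin n → A} (hv : ∀ i, v i ∈ 𝒜 1) :
    (List.ofFn v).prod ∈ oddIdeal 𝒜 ^ n := by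
  induction n with
  | zero => rw [Submodule.pow_zero, Ideal.one_eq_top]; trivial
  | succ n ih =>
    rw [List.ofFn_succ, List.prod_cons, Ideal.IsTwoSided.pow_succ]
    exact Ideal.mul_mem_mul (odd_mem_oddIdeal 𝒜 (hv 0)) (ih fun i => hv i.succ)

theorem lam_ι (m : OddGr 𝒜 1) : lam 𝒜 (ExteriorAlgebra.ι _ m) = grEmbedding 𝒜 m :=
  ExteriorAlgebra.lift_ι_apply _ _ _ _

theorem lam_ιMulti {n : ℕ} (v : Fin n → component 𝒜 1) :
    lam 𝒜 (ExteriorAlgebra.ιMulti (Body 𝒜) n fun i => oddClass 𝒜 (v i)) =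
      DirectSum.lof (Body 𝒜) ℕ (OddGr 𝒜) n (grMk (oddIdeal 𝒜) n
        ⟨(List.ofFn fun i => (v i : A)).prod, prod_mem_oddIdeal_pow 𝒜 fun i => (v i).2⟩) := by
  induction n with
  | zero =>
    rw [ExteriorAlgebra.ιMulti_zero_apply, map_one]
    rfl
  | succ n ih =>
    rw [ExteriorAlgebra.ιMulti_succ_apply, map_mul, lam_ι]
    have h := ih fun i => v i.succ
    simp only [Matrix.vecTail, Function.comp_def] at h ⊢
    rw [h]
    change DirectSum.of (OddGr 𝒜) 1 _ * DirectSum.of (OddGr 𝒜) n _ =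
      DirectSum.of (OddGr 𝒜) (n + 1) _
    rw [DirectSum.of_mul_of]
    refine DirectSum.of_eq_of_gradedMonoid_eq (grMk_congr _ (add_comm 1 n) _ _ ?_)
    simp [List.ofFn_succ]

/-- The associated graded ring is generated in degrees zero and one, because `I^(n+1) = I · I^n`. -/
theorem lam_surjective : Function.Surjective (lam 𝒜) := by
  have key : ∀ n (x : ↥(oddIdeal 𝒜 ^ n)),
      DirectSum.of (OddGr 𝒜) n (grMk (oddIdeal 𝒜) n x) ∈ (lam 𝒜).range := by
    intro n
    induction n with
    | zero =>
      intro x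
      refine ⟨algebraMap _ _ (Ideal.Quotient.mk (oddIdeal 𝒜) (x : A)), ?_⟩
      refine (AlgHom.commutes _ _).trans ?_
      change DirectSum.of (OddGr 𝒜) 0 _ = _
      congr 1
      change grMk (oddIdeal 𝒜) 0 _ = _
      congr 1
      exact Subtype.ext (mul_one _)
    | succ n ih =>
      rintro ⟨x, hx⟩
      have hx' := hx
      rw [Ideal.IsTwoSided.pow_succ] at hx'
      induction hx' using Submodule.smul_induction_on' with
      | smul a ha b hb =>
        obtain ⟨w, hw⟩ := ih ⟨b, hb⟩
        have ha1 : a ∈ oddIdeal 𝒜 ^ 1 := (Submodule.pow_one (oddIdeal 𝒜)).ge ha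
        refine ⟨ExteriorAlgebra.ι _ (grMk (oddIdeal 𝒜) 1 ⟨a, ha1⟩) * w, ?_⟩
        refine (map_mul _ _ _).trans ?_
        refine (congrArg₂ (· * ·) (lam_ι 𝒜 _) hw).trans ?_
        change DirectSum.of (OddGr 𝒜) 1 _ * DirectSum.of (OddGr 𝒜) n _ = _
        rw [DirectSum.of_mul_of]
        exact DirectSum.of_eq_of_gradedMonoid_eq (grMk_congr _ (add_comm 1 n) _ _ rfl)
      | add a ha b hb iha ihb =>
        have ha1 : a ∈ oddIdeal 𝒜 ^ (n + 1) := by rwa [Ideal.IsTwoSided.pow_succ]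
        have hb1 : b ∈ oddIdeal 𝒜 ^ (n + 1) := by rwa [Ideal.IsTwoSided.pow_succ]
        have h := add_mem (iha ha1) (ihb hb1)
        rw [← map_add, ← grMk_add] at h
        exact h
  intro y
  have : y ∈ (lam 𝒜).range := by
    induction y using DirectSum.induction_on with
    | zero => exact zero_mem _
    | of n x =>
      obtain ⟨x, rfl⟩ := grMk_surjective (oddIdeal 𝒜) n x
      exact key n x
    | add x y hx hy => exact add_mem hx hy
  exact this

theorem list_prod_mem_oddIdeal_pow {ι : Type*} {a : ι → A} (ha : ∀ i, a i ∈ 𝒜 1) (l : List ι) :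
    (l.map a).prod ∈ oddIdeal 𝒜 ^ l.length := by
  induction l with
  | nil => rw [List.length_nil, Submodule.pow_zero, Ideal.one_eq_top]; trivial
  | cons x l ih =>
    rw [List.map_cons, List.prod_cons, List.length_cons, Ideal.IsTwoSided.pow_succ]
    exact Ideal.mul_mem_mul (odd_mem_oddIdeal 𝒜 (ha x)) ih

variable {𝒜} in
/-- The products of free odd generators are linearly independent in `Iᵏ / Iᵏ⁺¹`, up to the
multiplicative set `S`. -/
theorem exists_mul_mem_oddIdeal_of_sum_mem {S : Submonoid (𝒜 0)} {n k : ℕ} {a : Fin n → A}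
    (ha : ∀ i, a i ∈ 𝒜 1) {t : S}
    (ht : ∀ x ∈ 𝒜 1, ((t : 𝒜 0) : A) * x ∈ Submodule.span (𝒜 0) (Set.range a))
    (hann : ∀ c : 𝒜 0, (c : A) * (List.ofFn a).prod = 0 →
      ∃ u : S, ((u : 𝒜 0) : A) * c ∈ oddIdeal 𝒜)
    {κ : Type*} [Fintype κ] {l : κ → List (Fin n)} (hl : ∀ j, (l j).Nodup)
    (hlk : ∀ j, (l j).length = k) (hlinj : ∀ i j, l i ⊆ l j → i = j) (c : κ → 𝒜 0)
    (hc : ∑ j, (c j : A) * ((l j).map a).prod ∈ oddIdeal 𝒜 ^ (k + 1)) (j : κ) :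
    ∃ u : S, ((u : 𝒜 0) : A) * c j ∈ oddIdeal 𝒜 := by
  classical
  -- Multiplying by the product over the complement of `l j` turns the `j`-th term into `± c j`
  -- times the full product. Every other `l i` has an index in the complement, so its term acquires
  -- a repeated factor and vanishes.
  let l' : List (Fin n) := (List.finRange n).filter (· ∉ l j)
  have hperm : (l j ++ l').Perm (List.finRange n) := by
    rw [List.perm_ext_iff_of_nodup _ (List.nodup_finRange n)]
    · intro i
      by_cases hi : i ∈ l j <;> simp [l', hi]
    · refine List.Nodup.append (hl j) ((List.nodup_finRange n).filter _) fun i hi hi' => ?_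
      simp [l'] at hi'
      exact hi' hi
  have hlen : k + l'.length = n := by
    have := hperm.length_eq
    rwa [List.length_append, hlk, List.length_finRange] at this
  have hne : ∀ i ≠ j, ((l i).map a).prod * (l'.map a).prod = 0 := by
    intro i hij
    have h1 : ¬ l i ⊆ l j := fun h => hij (hlinj i j h)
    obtain ⟨x, hx, hxj⟩ : ∃ x ∈ l i, x ∉ l j := by simpa [List.subset_def] using h1
    rw [← List.prod_append, ← List.map_append]
    refine odd_prod_eq_zero 𝒜 ha fun hnd => ?_
    have hx' : x ∈ l' := by simp [l', hxj]
    exact (List.nodup_append.1 hnd).2.2 x hx x hx' rfl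
  have hmul := mul_mem_pow_add (oddIdeal 𝒜) hc (list_prod_mem_oddIdeal_pow 𝒜 ha l')
  rw [Finset.sum_mul, Finset.sum_eq_single j (fun i _ hij => by rw [mul_assoc, hne i hij, mul_zero])
    (by simp), mul_assoc, ← List.prod_append, ← List.map_append, add_right_comm, hlen] at hmul
  -- The surviving term lies in `I^(n+1)`, one degree more than the `n` generators allow, so
  -- `t^(n+1)` kills it.
  have h0 := pow_mul_eq_zero 𝒜 (Nat.lt_succ_self n) ha ht hmul
  have h1 : ((t : 𝒜 0) : A) ^ (n + 1) * ((c j : A) * (List.ofFn a).prod) = 0 := by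
    rw [List.ofFn_eq_map]
    rcases odd_prod_perm 𝒜 ha hperm with h | h
    · rwa [h] at h0
    · rwa [h, mul_neg, mul_neg, neg_eq_zero] at h0
  obtain ⟨u, hu⟩ := hann ((t : 𝒜 0) ^ (n + 1) * c j) (by
    rw [← mul_assoc] at h1
    exact h1)
  refine ⟨u * t ^ (n + 1), ?_⟩
  convert hu using 1
  change ((u : 𝒜 0) : A) * ((t : 𝒜 0) : A) ^ (n + 1) * (c j : A) =
    ((u : 𝒜 0) : A) * (((t : 𝒜 0) : A) ^ (n + 1) * (c j : A))
  rw [mul_assoc]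

end GradedPieces

/-! ### From odd generators to projectivity and injectivity of `λ`. -/

section OfFreeGenerators

set_option linter.unusedSectionVars false

/-- The family spans its own span `N`, so the claim holds in the exterior algebra of `N`;
functoriality along `N → M` transports it. -/
theorem ιMulti_mem_span_ιMulti_family {B M : Type*} [CommRing B] [AddCommGroup M] [Module B M]
    {I : Type*} [LinearOrder I] {m : I → M} {k : ℕ} {v : Fin k → M}
    (hv : ∀ i, v i ∈ Submodule.span B (Set.range m)) :
    ExteriorAlgebra.ιMulti B k v ∈
      Submodule.span B (Set.range (ExteriorAlgebra.ιMulti_family B k m)) := by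
  set N := Submodule.span B (Set.range m) with hN
  let m' : I → N := fun i => ⟨m i, Submodule.subset_span ⟨i, rfl⟩⟩
  have hm' : Submodule.span B (Set.range m') = ⊤ :=
    (Submodule.span_range_subtype_eq_top_iff N (s := m) _).2 rfl
  have h1 : ExteriorAlgebra.ιMulti B k (fun i => (⟨v i, hv i⟩ : N)) ∈
      Submodule.span B (Set.range (ExteriorAlgebra.ιMulti_family B k m')) := by
    rw [exteriorPower.ιMulti_family_span_fixedDegree_of_span B hm']
    exact (exteriorPower.ιMulti B k _).2
  have h2 := Submodule.mem_map_of_mem (f := (ExteriorAlgebra.map N.subtype).toLinearMap) h1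
  rw [Submodule.map_span, ← Set.range_comp] at h2
  simp only [AlgHom.toLinearMap_apply, ExteriorAlgebra.map_apply_ιMulti] at h2
  refine Submodule.span_mono ?_ h2
  rintro _ ⟨J, rfl⟩
  exact ⟨J, (ExteriorAlgebra.map_apply_ιMulti N.subtype
    (m' ∘ Set.powersetCard.ofFinEmbEquiv.symm J)).symm⟩

variable {A : Type u} [Ring A] {𝒜 : ZMod 2 → AddSubgroup A} [GradedRing 𝒜] [SuperCommutative 𝒜]

theorem evenToBody_smul_mem_span {n : ℕ} {a : Fin n → component 𝒜 1} {t : 𝒜 0}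
    (ht : ∀ x ∈ 𝒜 1, (t : A) * x ∈ Submodule.span (𝒜 0) (Set.range fun i => (a i : A)))
    (m : OddGr 𝒜 1) :
    evenToBody 𝒜 t • m ∈ Submodule.span (Body 𝒜) (Set.range fun i => oddClass 𝒜 (a i)) := by
  obtain ⟨x, rfl⟩ := oddClass_surjective 𝒜 m
  rw [← oddClass_smul]
  have h : t • x ∈ Submodule.span (𝒜 0) (Set.range a) := by
    have h1 := ht x x.2
    have h2 : (Set.range fun i => (a i : A)) = (component 𝒜 1).subtype '' Set.range a := by
      rw [← Set.range_comp]
      rfl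
    rw [h2, ← Submodule.map_span] at h1
    obtain ⟨y, hy, hyx⟩ := h1
    rwa [show y = t • x from Subtype.ext hyx] at hy
  generalize t • x = y at h
  induction h using Submodule.span_induction with
  | mem y hy =>
    obtain ⟨i, rfl⟩ := hy
    exact Submodule.subset_span ⟨i, rfl⟩
  | zero =>
    rw [show oddClass 𝒜 0 = 0 from (oddClassₛₗ 𝒜).map_zero]
    exact zero_mem _
  | add y z _ _ hy hz => rw [oddClass_add]; exact add_mem hy hz
  | smul r y _ hy => rw [oddClass_smul]; exact Submodule.smul_mem _ _ hy

variable (P : Ideal (Body 𝒜)) [P.IsPrime]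

local notation "𝔖" => evenCompl 𝒜 (bodyComap 𝒜 P)

theorem exists_lam_eq_lof {k : ℕ} {y : ExteriorAlgebra (Body 𝒜) (OddGr 𝒜 1)}
    (hy : y ∈ ⋀[Body 𝒜]^k (OddGr 𝒜 1)) :
    ∃ z, lam 𝒜 y = DirectSum.lof (Body 𝒜) ℕ (OddGr 𝒜) k z := by
  rw [← ExteriorAlgebra.ιMulti_span_fixedDegree] at hy
  induction hy using Submodule.span_induction with
  | mem y hy =>
    obtain ⟨v, rfl⟩ := hy
    choose w hw using fun i => oddClass_surjective 𝒜 (v i)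
    obtain rfl : (fun i => oddClass 𝒜 (w i)) = v := funext hw
    exact ⟨_, lam_ιMulti 𝒜 w⟩
  | zero => exact ⟨0, by rw [map_zero, map_zero]⟩
  | add x y _ _ hx hy =>
    obtain ⟨z, hz⟩ := hx
    obtain ⟨w, hw⟩ := hy
    exact ⟨z + w, by rw [map_add, map_add, hz, hw]⟩
  | smul r x _ hx =>
    obtain ⟨z, hz⟩ := hx
    exact ⟨r • z, by rw [map_smul, map_smul, hz]⟩

/-- After multiplication by `τ^k`, one factor `τ` per wedge slot, `y` is a combination of increasing
wedges of the generators. Vanishing of `λ y` is then a relation among their products modulo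
`I^(k+1)`, so some `u J` outside the prime kills each coefficient. The product of the `u J` times
`τ^k` kills `y`. -/
theorem exists_smul_eq_zero_of_lam_eq_zero (h : HasFreeOddGeneratorsAt 𝒜 𝔖) {k : ℕ}
    {y : ExteriorAlgebra (Body 𝒜) (OddGr 𝒜 1)} (hy : y ∈ ⋀[Body 𝒜]^k (OddGr 𝒜 1))
    (hlam : lam 𝒜 y = 0) : ∃ b ∉ P, b • y = 0 := by
  classical
  obtain ⟨n, a, ha, ⟨t, ht⟩, hann⟩ := h
  let a' : Fin n → component 𝒜 1 := fun i => ⟨a i, ha i⟩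
  let m : Fin n → OddGr 𝒜 1 := fun i => oddClass 𝒜 (a' i)
  let τ := evenToBody 𝒜 t
  have h1 : τ ^ k • y ∈ Submodule.span (Body 𝒜)
      (Set.range (ExteriorAlgebra.ιMulti_family (Body 𝒜) k m)) := by
    clear hlam
    rw [← ExteriorAlgebra.ιMulti_span_fixedDegree] at hy
    induction hy using Submodule.span_induction with
    | mem y hy =>
      obtain ⟨v, rfl⟩ := hy
      have h2 := (ExteriorAlgebra.ιMulti (Body 𝒜) k).map_smul_univ (fun _ => τ) v
      rw [Finset.prod_const, Finset.card_univ, Fintype.card_fin] at h2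
      rw [← h2]
      exact ιMulti_mem_span_ιMulti_family fun i => evenToBody_smul_mem_span (a := a') ht (v i)
    | zero => rw [smul_zero]; exact zero_mem _
    | add x y _ _ hx hy => rw [smul_add]; exact add_mem hx hy
    | smul r x _ hx => rw [smul_comm]; exact Submodule.smul_mem _ _ hx
  let := Fintype.ofFinite (Set.powersetCard (Fin n) k)
  obtain ⟨b, hb⟩ := (Submodule.mem_span_range_iff_exists_fun _).1 h1
  choose c hc using fun J => evenToBody_surjective 𝒜 (b J)
  let idx : Set.powersetCard (Fin n) k → Fin k ↪o Fin n := Set.powersetCard.ofFinEmbEquiv.symm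
  let p : Set.powersetCard (Fin n) k → ↥(oddIdeal 𝒜 ^ k) := fun J =>
    ⟨(List.ofFn fun i => a (idx J i)).prod, prod_mem_oddIdeal_pow 𝒜 fun i => ha (idx J i)⟩
  have h2 : lam 𝒜 (τ ^ k • y) = DirectSum.lof (Body 𝒜) ℕ (OddGr 𝒜) k
      (grMk (oddIdeal 𝒜) k (∑ J, (c J : A) • p J)) := by
    have h3 : grMk (oddIdeal 𝒜) k (∑ J, (c J : A) • p J) =
        ∑ J, b J • grMk (oddIdeal 𝒜) k (p J) := by
      have h4 : ∀ T : Finset (Set.powersetCard (Fin n) k),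
          grMk (oddIdeal 𝒜) k (∑ J ∈ T, (c J : A) • p J) =
            ∑ J ∈ T, b J • grMk (oddIdeal 𝒜) k (p J) := by
        intro T
        induction T using Finset.induction_on with
        | empty => rfl
        | insert J T hJ ih =>
          rw [Finset.sum_insert hJ, Finset.sum_insert hJ, grMk_add, ih, ← hc]
          rfl
      exact h4 _
    rw [h3, map_sum, ← hb, map_sum]
    refine Finset.sum_congr rfl fun J _ => ?_
    rw [map_smul, map_smul]
    congr 1
    exact lam_ιMulti 𝒜 fun i => a' (idx J i)
  rw [map_smul, hlam, smul_zero] at h2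
  have h3 := DirectSum.of_injective (β := OddGr 𝒜) k (h2.symm.trans (map_zero _).symm)
  have h4 : ∑ J, (c J : A) * ((List.ofFn (idx J)).map a).prod ∈ oddIdeal 𝒜 ^ (k + 1) := by
    have h5 := (grMk_eq_iff (oddIdeal 𝒜) (y := 0)).1 h3
    rw [ZeroMemClass.coe_zero, sub_zero, AddSubmonoidClass.coe_finsetSum] at h5
    convert h5 using 2 with J
    rw [List.map_ofFn]
    rfl
  choose u hu using exists_mul_mem_oddIdeal_of_sum_mem ha ht hann
    (fun J => List.nodup_ofFn.2 (idx J).injective) (fun J => List.length_ofFn) (fun J K hJK => by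
      refine Set.powersetCard.eq_iff_subset.2 fun i hi => ?_
      rw [Set.powersetCard.mem_coe_iff, ← Set.powersetCard.mem_range_ofFinEmbEquiv_symm_iff_mem] at hi ⊢
      exact (List.mem_ofFn' _ _).1 (hJK ((List.mem_ofFn' _ _).2 hi))) c h4
  refine ⟨evenToBody 𝒜 ((∏ J, u J : 𝔖) * (t : 𝒜 0) ^ k),
    (mul_mem (∏ J, u J : 𝔖).2 (pow_mem t.2 k) :), ?_⟩
  rw [map_mul, map_pow, mul_smul]
  change _ • τ ^ k • y = 0
  rw [← hb, Finset.smul_sum]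
  refine Finset.sum_eq_zero fun J _ => ?_
  have h6 : evenToBody 𝒜 ((∏ J, u J : 𝔖) : 𝒜 0) * b J = 0 := by
    rw [← Finset.prod_erase_mul _ _ (Finset.mem_univ J), ← hc, ← map_mul,
      evenToBody_eq_zero_iff]
    change (((∏ j ∈ Finset.univ.erase J, u j : 𝔖) : 𝒜 0) : A) * ((u J : 𝒜 0) : A) * (c J : A) ∈ _
    rw [mul_assoc]
    exact Ideal.mul_mem_left _ _ (hu J)
  rw [smul_smul, h6, zero_smul]

/-- The annihilator of `x` lies in no prime, in particular in no maximal ideal. -/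
theorem eq_zero_of_forall_exists_smul_eq_zero {B M : Type*} [CommRing B] [AddCommGroup M]
    [Module B M] {x : M} (h : ∀ (P : Ideal B) [P.IsPrime], ∃ b ∉ P, b • x = 0) : x = 0 := by
  by_contra hx
  have hne : LinearMap.ker (LinearMap.toSpanSingleton B M x) ≠ ⊤ := by
    rw [Ideal.ne_top_iff_one]
    simpa using hx
  obtain ⟨P, hP, hle⟩ := Ideal.exists_le_maximal _ hne
  have := hP.isPrime
  obtain ⟨b, hb, hbx⟩ := h P
  exact hb (hle hbx)

theorem lam_injective_of_hasFreeOddGeneratorsAt (h : ∀ (P : Ideal (Body 𝒜)) [P.IsPrime],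
    HasFreeOddGeneratorsAt 𝒜 (evenCompl 𝒜 (bodyComap 𝒜 P))) : Function.Injective (lam 𝒜) := by
  classical
  rw [injective_iff_map_eq_zero]
  intro x hx
  let 𝓔 : ℕ → Submodule (Body 𝒜) (ExteriorAlgebra (Body 𝒜) (OddGr 𝒜 1)) :=
    fun k => ⋀[Body 𝒜]^k (OddGr 𝒜 1)
  choose z hz using fun k => exists_lam_eq_lof (DirectSum.decompose 𝓔 x k).2
  rw [← DirectSum.sum_support_decompose 𝓔 x]
  refine Finset.sum_eq_zero fun k hk => ?_
  refine eq_zero_of_forall_exists_smul_eq_zero fun P _ =>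
    exists_smul_eq_zero_of_lam_eq_zero P (h P) (DirectSum.decompose 𝓔 x k).2 ?_
  -- Since `λ` respects degrees, the homogeneous components of `x` are killed separately.
  rw [← DirectSum.sum_support_decompose 𝓔 x, map_sum, Finset.sum_congr rfl fun k _ => hz k] at hx
  have h1 := congrArg (DirectSum.component (Body 𝒜) ℕ (OddGr 𝒜) k) hx
  rw [map_sum, map_zero, Finset.sum_eq_single k, DirectSum.component.lof_self] at h1
  · rw [hz, h1, map_zero]
  · intro j _ hjk
    rw [DirectSum.component.of, dif_neg hjk]
  · exact fun h => absurd hk h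

/-- For a finitely presented module projectivity is local. At `P`, the map from a free module given
by the classes of the generators becomes bijective: onto because of `t`, one-to-one by the degree
one relations. -/
theorem projective_of_hasFreeOddGeneratorsAt (hA : IsNoetherianSuperRing 𝒜)
    (h : ∀ (P : Ideal (Body 𝒜)) [P.IsPrime],
      HasFreeOddGeneratorsAt 𝒜 (evenCompl 𝒜 (bodyComap 𝒜 P))) :
    Module.Projective (Body 𝒜) (OddGr 𝒜 1) := by
  have := hA.isNoetherianRing_even
  have := hA.isNoetherian_component 1
  have := isNoetherianRing_body 𝒜
  have := oddGr_one_finite 𝒜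
  have : Module.FinitePresentation (Body 𝒜) (OddGr 𝒜 1) :=
    Module.finitePresentation_of_finite _ _
  refine Module.projective_of_localization_maximal fun P hP => ?_
  have := hP.isPrime
  obtain ⟨n, a, ha, ⟨t, ht⟩, hann⟩ := h P
  let a' : Fin n → component 𝒜 1 := fun i => ⟨a i, ha i⟩
  let m : Fin n → OddGr 𝒜 1 := fun i => oddClass 𝒜 (a' i)
  let f : (Fin n → Body 𝒜) →ₗ[Body 𝒜] OddGr 𝒜 1 := Fintype.linearCombination (Body 𝒜) m
  have hker : ∀ y, f y = 0 → ∃ u : P.primeCompl, u • y = 0 := by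
    intro y hy
    choose c hc using fun i => evenToBody_surjective 𝒜 (y i)
    have h1 : f y = oddClass 𝒜 (∑ i, c i • a' i) := by
      change f y = oddClassₛₗ 𝒜 _
      rw [map_sum, Fintype.linearCombination_apply]
      refine Finset.sum_congr rfl fun i _ => ?_
      rw [map_smulₛₗ, hc]
      rfl
    rw [hy, eq_comm, oddClass_eq_zero_iff] at h1
    have h2 : ∑ i, (c i : A) * (([i] : List (Fin n)).map a).prod ∈ oddIdeal 𝒜 ^ (1 + 1) := by
      rw [AddSubmonoidClass.coe_finsetSum] at h1
      convert h1 using 2 with i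
      simp
      rfl
    -- The case `k = 1`, with singleton lists of indices.
    choose u hu using exists_mul_mem_oddIdeal_of_sum_mem ha ht hann
      (fun i => List.nodup_singleton i) (fun i => rfl) (fun i j hij => by simpa using hij) c h2
    refine ⟨⟨evenToBody 𝒜 (∏ i, u i : evenCompl 𝒜 (bodyComap 𝒜 P)), (∏ i, u i).2⟩, ?_⟩
    ext i
    change evenToBody 𝒜 (∏ i, u i : evenCompl 𝒜 (bodyComap 𝒜 P)) * y i = 0
    rw [← Finset.prod_erase_mul _ _ (Finset.mem_univ i), ← hc, ← map_mul, evenToBody_eq_zero_iff]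
    change (((∏ j ∈ Finset.univ.erase i, u j : evenCompl 𝒜 (bodyComap 𝒜 P)) : 𝒜 0) : A) *
      ((u i : 𝒜 0) : A) * (c i : A) ∈ _
    rw [mul_assoc]
    exact Ideal.mul_mem_left _ _ (hu i)
  let τ : P.primeCompl := ⟨evenToBody 𝒜 t, t.2⟩
  let F := LocalizedModule.map P.primeCompl f
  have hF : Function.Bijective F := by
    constructor
    · rw [injective_iff_map_eq_zero]
      intro x hx
      induction x with
      | _ y s =>
        rw [LocalizedModule.map_mk, ← LocalizedModule.zero_mk 1, LocalizedModule.mk_eq] at hx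
        obtain ⟨u, hu⟩ := hx
        simp only [one_smul, smul_zero] at hu
        obtain ⟨v, hv⟩ := hker ((u : Body 𝒜) • y) (by rw [map_smul]; exact hu)
        rw [← LocalizedModule.zero_mk 1, LocalizedModule.mk_eq]
        refine ⟨v * u, ?_⟩
        simp only [one_smul, smul_zero, mul_smul]
        exact hv
    · intro x
      induction x with
      | _ x s =>
        have h1 := evenToBody_smul_mem_span (a := a') ht x
        obtain ⟨y, hy⟩ := (Submodule.mem_span_range_iff_exists_fun _).1 h1
        refine ⟨LocalizedModule.mk y (τ * s), ?_⟩
        rw [LocalizedModule.map_mk, Fintype.linearCombination_apply]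
        refine (congrArg (fun w => LocalizedModule.mk w (τ * s)) hy).trans ?_
        exact LocalizedModule.mk_cancel_common_left τ s x
  exact Module.Projective.of_equiv (LinearEquiv.ofBijective F hF)

end OfFreeGenerators

/-! ### From projectivity and injectivity of `λ` back to odd generators. -/

section OfProjective

set_option linter.unusedSectionVars false

variable {A : Type u} [Ring A] {𝒜 : ZMod 2 → AddSubgroup A} [GradedRing 𝒜] [SuperCommutative 𝒜]

/-- The odd part of `a b` is `a₁ b₀ + a₀ b₁`, with even parts in the nilpotent ideal `q = I ∩ A₀`.
Equality in `I/I²` thus becomes equality modulo `q A₁`, as Nakayama requires. -/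
theorem mem_ker_smul_of_mem_sq {x : A} (hx : x ∈ oddIdeal 𝒜 ^ 2) :
    (DirectSum.decompose 𝒜 x 1 : A) ∈ RingHom.ker (evenToBody 𝒜) • component 𝒜 1 := by
  rw [Submodule.pow_succ, Submodule.pow_one] at hx
  have h0 : ∀ a ∈ oddIdeal 𝒜, DirectSum.decompose 𝒜 a 0 ∈ RingHom.ker (evenToBody 𝒜) := by
    intro a ha
    rw [RingHom.mem_ker, ← mk_eq_evenToBody]
    exact Ideal.Quotient.eq_zero_iff_mem.2 ha
  induction hx using Submodule.smul_induction_on' with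
  | smul a ha b hb =>
    rw [smul_eq_mul, decompose_one_mul, ← even_comm 𝒜 (SetLike.coe_mem _)]
    exact add_mem (Submodule.smul_mem_smul (h0 b hb) (SetLike.coe_mem _))
      (Submodule.smul_mem_smul (h0 a ha) (SetLike.coe_mem _))
  | add a _ b _ ha hb =>
    rw [DirectSum.decompose_add, DirectSum.add_apply, AddSubgroup.coe_add]
    exact add_mem ha hb

/-- A denominator clearing version of Nakayama's lemma for a nilpotent ideal. -/
theorem exists_pow_smul_mem_of_nilpotent {R M : Type*} [CommRing R] [AddCommGroup M] [Module R M]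
    {N C : Submodule R M} {q : Ideal R} (hq : IsNilpotent q) {t : R}
    (h : ∀ x ∈ C, t • x ∈ N ⊔ q • C) : ∃ k : ℕ, ∀ x ∈ C, t ^ k • x ∈ N := by
  -- Each further factor `t` buys a further factor of `q` in the error term, until `q^k = 0`.
  have key : ∀ k : ℕ, ∀ x ∈ C, t ^ k • x ∈ N ⊔ q ^ k • C := by
    intro k
    induction k with
    | zero =>
      intro x hx
      rw [pow_zero, pow_zero, one_smul, one_smul]
      exact Submodule.mem_sup_right hx
    | succ k ih =>
      intro x hx
      obtain ⟨y, hy, z, hz, hyz⟩ := Submodule.mem_sup.1 (ih x hx)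
      rw [pow_succ' t, mul_smul, ← hyz, smul_add]
      refine add_mem (Submodule.mem_sup_left (N.smul_mem t hy)) ?_
      clear hyz
      induction hz using Submodule.smul_induction_on' with
      | smul r hr c hc =>
        obtain ⟨y, hy, w, hw, hyw⟩ := Submodule.mem_sup.1 (h c hc)
        rw [smul_comm, ← hyw, smul_add, pow_succ, mul_smul]
        exact add_mem (Submodule.mem_sup_left (N.smul_mem r hy))
          (Submodule.mem_sup_right (Submodule.smul_mem_smul hr hw))
      | add a _ b _ ha hb =>
        rw [smul_add]
        exact add_mem ha hb
  obtain ⟨k, hk⟩ := hq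
  refine ⟨k, fun x hx => ?_⟩
  have h1 := key k x hx
  rwa [hk, Ideal.zero_eq_bot, Submodule.bot_smul, sup_bot_eq] at h1

/-- A finite projective module is locally free: there are elements forming a basis of the
localization at a prime. -/
theorem exists_basis_localizedModule {B M : Type*} [CommRing B] [AddCommGroup M] [Module B M]
    [Module.Finite B M] [Module.Projective B M] (P : Ideal B) [P.IsPrime] :
    ∃ (n : ℕ) (m : Fin n → M)
      (b : Module.Basis (Fin n) (Localization.AtPrime P) (LocalizedModule P.primeCompl M)),
      ∀ i, b i = LocalizedModule.mk (m i) 1 := by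
  have : Module.Free (Localization.AtPrime P) (LocalizedModule P.primeCompl M) :=
    Module.free_of_flat_of_isLocalRing
  let b := Module.finBasis (Localization.AtPrime P) (LocalizedModule P.primeCompl M)
  have hb : ∀ i, ∃ (m : M) (s : P.primeCompl), b i = LocalizedModule.mk m s := by
    intro i
    induction b i with
    | _ m s => exact ⟨m, s, rfl⟩
  choose m s hms using hb
  have hu : ∀ i, IsUnit (algebraMap B (Localization.AtPrime P) (s i)) := fun i =>
    IsLocalization.map_units _ (s i)
  -- Rescaling by the denominators, which are units in the localization, leaves numerators only.
  refine ⟨_, m, b.isUnitSMul hu, fun i => ?_⟩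
  rw [Module.Basis.isUnitSMul_apply, hms, algebraMap_smul, LocalizedModule.smul'_mk,
    ← LocalizedModule.mk_cancel (s i)]
  rfl

theorem exists_smul_mem_span_of_basis {B M : Type*} [CommRing B] [AddCommGroup M] [Module B M]
    [Module.Finite B M] {P : Ideal B} [P.IsPrime] {n : ℕ} {m : Fin n → M}
    (b : Module.Basis (Fin n) (Localization.AtPrime P) (LocalizedModule P.primeCompl M))
    (hb : ∀ i, b i = LocalizedModule.mk (m i) 1) :
    ∃ t ∉ P, ∀ x : M, t • x ∈ Submodule.span B (Set.range m) := by
  have h1 : ∀ x : M, ∃ t : P.primeCompl, t • x ∈ Submodule.span B (Set.range m) := by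
    intro x
    have hx : ∀ y : LocalizedModule P.primeCompl M, ∃ w ∈ Submodule.span B (Set.range m),
        ∃ s : P.primeCompl, y = LocalizedModule.mk w s := by
      intro y
      have hy : y ∈ Submodule.span (Localization.AtPrime P) (Set.range b) := b.span_eq ▸ trivial
      induction hy using Submodule.span_induction with
      | mem y hy =>
        obtain ⟨i, rfl⟩ := hy
        exact ⟨_, Submodule.subset_span ⟨i, rfl⟩, 1, hb i⟩
      | zero => exact ⟨0, zero_mem _, 1, (LocalizedModule.zero_mk 1).symm⟩
      | add x y _ _ hx hy =>
        obtain ⟨v, hv, s, rfl⟩ := hx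
        obtain ⟨w, hw, t, rfl⟩ := hy
        exact ⟨_, add_mem (Submodule.smul_mem _ (t : B) hv) (Submodule.smul_mem _ (s : B) hw), _,
          LocalizedModule.mk_add_mk⟩
      | smul r x _ hx =>
        obtain ⟨v, hv, s, rfl⟩ := hx
        induction r using Localization.induction_on with
        | _ r =>
          exact ⟨_, Submodule.smul_mem _ r.1 hv, _, LocalizedModule.mk_smul_mk r.1 v r.2 s⟩
    obtain ⟨w, hw, s, hws⟩ := hx (LocalizedModule.mk x 1)
    obtain ⟨u, hu⟩ := LocalizedModule.mk_eq.1 hws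
    refine ⟨u * s, ?_⟩
    rw [mul_smul, hu, one_smul]
    exact Submodule.smul_mem _ (u : B) hw
  obtain ⟨k, g, hg⟩ := Module.Finite.exists_fin (R := B) (M := M)
  choose t ht using fun i => h1 (g i)
  refine ⟨_, (∏ i, t i : P.primeCompl).2, fun x => ?_⟩
  have hx : x ∈ Submodule.span B (Set.range g) := hg ▸ trivial
  induction hx using Submodule.span_induction with
  | mem x hx =>
    obtain ⟨i, rfl⟩ := hx
    rw [← Finset.prod_erase_mul _ _ (Finset.mem_univ i), Submonoid.coe_mul, mul_smul]
    exact Submodule.smul_mem _ _ (ht i)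
  | zero => simp
  | add x y _ _ hx hy => rw [smul_add]; exact add_mem hx hy
  | smul r x _ hx => rw [smul_comm]; exact Submodule.smul_mem _ r hx

/-- The determinant in the basis `b`, pulled back to `M`, is an alternating form with values in
`B_P` that equals `1` on `m`. The induced functional on the exterior power sends `c` times the wedge
of `m` to `c/1`, which must vanish. -/
theorem exists_mul_eq_zero_of_smul_ιMulti_eq_zero {B M : Type*} [CommRing B] [AddCommGroup M]
    [Module B M] {P : Ideal B} [P.IsPrime] {n : ℕ} {m : Fin n → M}
    (b : Module.Basis (Fin n) (Localization.AtPrime P) (LocalizedModule P.primeCompl M))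
    (hb : ∀ i, b i = LocalizedModule.mk (m i) 1) {c : B}
    (hc : c • ExteriorAlgebra.ιMulti B n m = 0) : ∃ u ∉ P, u * c = 0 := by
  let D : M [⋀^Fin n]→ₗ[B] Localization.AtPrime P :=
    { (b.det.toMultilinearMap.restrictScalars B).compLinearMap
        fun _ => LocalizedModule.mkLinearMap P.primeCompl M with
      map_eq_zero_of_eq' := fun v i j hv hij =>
        b.det.map_eq_zero_of_eq _ (congrArg (LocalizedModule.mkLinearMap P.primeCompl M) hv) hij }
  have hD : D m = 1 := by
    have h : (fun i => LocalizedModule.mkLinearMap P.primeCompl M (m i)) = b :=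
      funext fun i => (hb i).symm
    change b.det (fun i => LocalizedModule.mkLinearMap P.primeCompl M (m i)) = 1
    rw [h, Module.Basis.det_self]
  have h1 : c • exteriorPower.ιMulti B n m = 0 := Subtype.ext hc
  have h2 := congrArg (exteriorPower.alternatingMapLinearEquiv D) h1
  rw [map_smul, exteriorPower.alternatingMapLinearEquiv_apply_ιMulti, hD, map_zero,
    Algebra.smul_def, mul_one] at h2
  obtain ⟨u, hu⟩ := (IsLocalization.map_eq_zero_iff P.primeCompl _ c).1 h2
  exact ⟨u, u.2, hu⟩

/-- Odd lifts of a local basis of `I/I²` do the job. They generate up to a power of `t` by the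
nilpotent Nakayama lemma. If `c` kills their product, then `λ` kills the class of `c` times the
wedge of the basis; injectivity and the determinant finish. -/
theorem hasFreeOddGeneratorsAt_of_projective (hA : IsNoetherianSuperRing 𝒜)
    [Module.Projective (Body 𝒜) (OddGr 𝒜 1)] (hlam : Function.Injective (lam 𝒜))
    (P : Ideal (Body 𝒜)) [P.IsPrime] :
    HasFreeOddGeneratorsAt 𝒜 (evenCompl 𝒜 (bodyComap 𝒜 P)) := by
  have := hA.isNoetherianRing_even
  have := hA.isNoetherian_component 1
  have := oddGr_one_finite 𝒜
  obtain ⟨n, m, b, hb⟩ := exists_basis_localizedModule (M := OddGr 𝒜 1) P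
  choose a ha using fun i => oddClass_surjective 𝒜 (m i)
  obtain ⟨t, htP, ht⟩ := exists_smul_mem_span_of_basis b hb
  obtain ⟨t, rfl⟩ := evenToBody_surjective 𝒜 t
  refine ⟨n, fun i => a i, fun i => (a i).2, ?_, fun c hc => ?_⟩
  · set N := Submodule.span (𝒜 0) (Set.range fun i => (a i : A)) with hN
    -- A nil ideal that is finitely generated is nilpotent; this is where `A₀` is used as a
    -- Noetherian ring.
    have hq : IsNilpotent (RingHom.ker (evenToBody 𝒜)) :=
      (Ideal.FG.isNilpotent_iff_le_nilradical (Ideal.fg_of_isNoetherianRing _)).2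
        (ker_evenToBody_le_nilradical 𝒜)
    have hspan : ∀ y ∈ Submodule.span (Body 𝒜) (Set.range m), ∃ w : component 𝒜 1,
        (w : A) ∈ N ∧ oddClass 𝒜 w = y := by
      intro y hy
      induction hy using Submodule.span_induction with
      | mem y hy =>
        obtain ⟨i, rfl⟩ := hy
        exact ⟨a i, Submodule.subset_span ⟨i, rfl⟩, ha i⟩
      | zero => exact ⟨0, zero_mem _, (oddClassₛₗ 𝒜).map_zero⟩
      | add x y _ _ hx hy =>
        obtain ⟨v, hv, rfl⟩ := hx
        obtain ⟨w, hw, rfl⟩ := hy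
        exact ⟨v + w, add_mem hv hw, rfl⟩
      | smul r x _ hx =>
        obtain ⟨v, hv, rfl⟩ := hx
        obtain ⟨r, rfl⟩ := evenToBody_surjective 𝒜 r
        exact ⟨r • v, N.smul_mem r hv, rfl⟩
    obtain ⟨k, hk⟩ := exists_pow_smul_mem_of_nilpotent (N := N) (C := component 𝒜 1) hq (t := t)
      (fun x hx => by
        obtain ⟨w, hw, hwx⟩ := hspan _ (ht (oddClass 𝒜 ⟨x, hx⟩))
        rw [← oddClass_smul] at hwx
        have h1 : oddClass 𝒜 (t • ⟨x, hx⟩ - w) = 0 := by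
          have h2 := (oddClassₛₗ 𝒜).map_sub (t • ⟨x, hx⟩) w
          exact h2.trans (sub_eq_zero.2 hwx.symm)
        have h3 := mem_ker_smul_of_mem_sq ((oddClass_eq_zero_iff 𝒜).1 h1)
        rw [DirectSum.decompose_of_mem_same 𝒜 (t • ⟨x, hx⟩ - w : component 𝒜 1).2] at h3
        refine Submodule.mem_sup.2 ⟨w, hw, _, h3, ?_⟩
        simp)
    let t' : evenCompl 𝒜 (bodyComap 𝒜 P) := ⟨t, htP⟩
    exact ⟨t' ^ k, fun x hx => hk x hx⟩
  · have h1 : evenToBody 𝒜 c • ExteriorAlgebra.ιMulti (Body 𝒜) n m = 0 := by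
      refine hlam ?_
      rw [map_smul, map_zero, ← funext ha, lam_ιMulti, ← map_smul]
      refine (congrArg _ ?_).trans (map_zero _)
      refine (grMk_eq_iff (oddIdeal 𝒜) (y := 0)).2 ?_
      change (c : A) * (List.ofFn fun i => (a i : A)).prod - 0 ∈ _
      rw [hc, sub_zero]
      exact zero_mem _
    obtain ⟨u, huP, hu⟩ := exists_mul_eq_zero_of_smul_ιMulti_eq_zero b hb h1
    obtain ⟨u, rfl⟩ := evenToBody_surjective 𝒜 u
    refine ⟨⟨u, huP⟩, ?_⟩
    rw [← map_mul, evenToBody_eq_zero_iff] at hu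
    exact hu

end OfProjective

end SuperRing

theorem mainTheorem3 {A : Type u} [Ring A] (𝒜 : ZMod 2 → AddSubgroup A) [GradedRing 𝒜]
    [SuperCommutative 𝒜] (hA : SuperRing.IsNoetherianSuperRing 𝒜) :
    SuperRing.IsRegular 𝒜 ↔
      IsRegularRing (SuperRing.Body 𝒜) ∧
      Module.Projective (SuperRing.Body 𝒜) (SuperRing.OddGr 𝒜 1) ∧
      Function.Bijective (SuperRing.lam 𝒜) := by
  rw [SuperRing.isRegular_iff hA, and_congr_right_iff]
  intro _
  constructor
  · intro h
    exact ⟨SuperRing.projective_of_hasFreeOddGeneratorsAt hA h,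
      SuperRing.lam_injective_of_hasFreeOddGeneratorsAt h, SuperRing.lam_surjective 𝒜⟩
  · rintro ⟨_, hlam⟩ P _
    exact SuperRing.hasFreeOddGeneratorsAt_of_projective hA hlam.1 P
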